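/- Let $0<\alpha<1$ and let $L=(L(t))_{t\ge 0}$ be an $\alpha$-selfsimilar one-sided Lévy process (subordinator): $L(0)=0$, $L$ is continuous in probability, has stationary, independent and non-negative increments and (almost surely) càdlàg paths, and $$\mathbf E\big[e^{-\omega L(t)}\big]=\exp\Big\{-t\int_0^\infty (1-e^{-\omega x})\,\lambda(dx)\Big\}\qquad(\omega\ge 0,\ t\ge 0),$$ where the Lévy measure $\lambda$ on $(0,\infty)$ satisfies $\int_0^\infty\min\{x,1\}\,\lambda(dx)<\infty$ and has tail $\lambda((x,\infty))=x^{-\alpha}$ for every $x>0$. For $t>0$ and $n\ge1$ let $X_n(t)$ denote the size of the $n$-th largest jump of $L$ (counted with multiplicity) during the time interval $[0,t]$. Then for every $t>0$, every integer $K\ge 1$ and all real numbers $1\ge a_1>a_2>\dots>a_K>a_{K+1}=0$, $$\mathbf P\Big(a_{k+1}<\frac{X_{k+1}(t)}{X_1(t)}<a_k\ \text{ for all } k=1,\dots,K\Big)=\Gamma(K)\,(a_K)^{\alpha K}\prod_{k=1}^{K-1}\Big(\frac1{(a_{k+1})^{\alpha}}-\frac1{(a_k)^{\alpha}}\Big),$$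 where the empty product (for $K=1$) equals $1$. In particular this probability does not depend on $t$. -/

import Mathlib

open MeasureTheory ProbabilityTheory Filter Topology
open scoped NNReal ENNReal

/-- A path is càdlàg: right-continuous with (finite) left limits. -/
def IsCadlagPath (f : ℝ≥0 → ℝ) : Prop :=
  ∀ s : ℝ≥0, ContinuousWithinAt f (Set.Ici s) s ∧ ∃ l : ℝ, Tendsto f (𝓝[<] s) (𝓝 l)

/-- One-sided Lévy process (subordinator): a process started at `0`, with independent and
stationary increments, continuous in probability, with non-negative increments, and (so that its
jumps make sense) with almost surely càdlàg paths. -/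
structure IsOneSidedLevyProcess {Ω : Type*} [MeasurableSpace Ω]
    (L : ℝ≥0 → Ω → ℝ) (P : Measure Ω) : Prop where
  measurable : ∀ s, Measurable (L s)
  start_zero : ∀ᵐ ω ∂P, L 0 ω = 0
  indep_increments : HasIndepIncrements L P
  stationary_increments : ∀ s h : ℝ≥0, IdentDistrib (L (s + h) - L s) (L h - L 0) P P
  nonneg_increments : ∀ s u : ℝ≥0, s ≤ u → ∀ᵐ ω ∂P, 0 ≤ L u ω - L s ω
  continuous_in_probability : ∀ s : ℝ≥0, TendstoInMeasure P L (𝓝 s) (L s)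
  cadlag : ∀ᵐ ω ∂P, IsCadlagPath (fun s => L s ω)

/-- Lévy measures of one-sided Lévy processes: measures carried by `(0, ∞)` with
`∫ min {x, 1} ν(dx) < ∞`. -/
structure IsOneSidedLevyMeasure (ν : Measure ℝ) : Prop where
  carried : ν (Set.Iic 0) = 0
  integrability : ∫⁻ x, ENNReal.ofReal (min x 1) ∂ν < ∞

/-- The Lévy characteristic `Ψ(θ) = ∫ (1 - exp(-θ x)) ν(dx)`. -/
noncomputable def levyCharacteristic (ν : Measure ℝ) (θ : ℝ) : ℝ :=
  ∫ x, (1 - Real.exp (-(θ * x))) ∂ν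

/-- `L` has (Laplace) Lévy–Khinchin representation with Lévy measure `ν` and no drift:
`E[exp(-θ L(s))] = exp(-Ψ(θ) s)` for all `θ ≥ 0`, `s ≥ 0`. -/
def HasLevyMeasure {Ω : Type*} [MeasurableSpace Ω]
    (L : ℝ≥0 → Ω → ℝ) (P : Measure Ω) (ν : Measure ℝ) : Prop :=
  ∀ (θ : ℝ) (s : ℝ≥0), 0 ≤ θ →
    ∫ ω, Real.exp (-(θ * L s ω)) ∂P = Real.exp (-(levyCharacteristic ν θ * (s : ℝ)))

/-- The flight tail `Λ(x) = ν((x, ∞))`. -/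
noncomputable def flightTail (ν : Measure ℝ) (x : ℝ) : ℝ≥0∞ := ν (Set.Ioi x)

/-- An `α`-selfsimilar one-sided Lévy process: its Lévy measure has flight tail
`Λ(x) = 1 / x ^ α` for `x > 0`. -/
def IsSelfsimilarOLP {Ω : Type*} [MeasurableSpace Ω]
    (α : ℝ) (L : ℝ≥0 → Ω → ℝ) (P : Measure Ω) : Prop :=
  IsOneSidedLevyProcess L P ∧
    ∃ ν : Measure ℝ, IsOneSidedLevyMeasure ν ∧ HasLevyMeasure L P ν ∧
      ∀ x : ℝ, 0 < x → flightTail ν x = ENNReal.ofReal (1 / x ^ α)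

/-- The flight (jump) of the path `f` at time `s`: `f(s) - f(s-)`. It is `0` at `s = 0`. -/
noncomputable def flight (f : ℝ≥0 → ℝ) (s : ℝ≥0) : ℝ := f s - Function.leftLim f s

/-- The size of the `n`-th largest flight (`n ≥ 1`, counted with multiplicity) of the path `f`
during `[0, t]`: the largest level `x > 0` such that at least `n` flights in `[0, t]` have size
at least `x`. (For a càdlàg path only finitely many flights exceed a given level, so the supremum
is attained as soon as there are at least `n` positive flights; otherwise the value is `0`.) -/
noncomputable def nthLargestFlight (f : ℝ≥0 → ℝ) (t : ℝ≥0) (n : ℕ) : ℝ :=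
  sSup {x : ℝ | 0 < x ∧ (n : ℕ∞) ≤ Set.encard {s : ℝ≥0 | s ≤ t ∧ x ≤ flight f s}}

/-- The order sequence `X_n(t)` of the flights of the process `L`. -/
noncomputable def orderSeq {Ω : Type*} (L : ℝ≥0 → Ω → ℝ) (n : ℕ) (t : ℝ≥0) (ω : Ω) : ℝ :=
  nthLargestFlight (fun s => L s ω) t n

/-! Large jumps can be read off from increments over fine grids. Cut `[0, t]` into `m` equal
intervals and fix a càdlàg path and a level `x > 0`. For large `m`, at least `n` increments reach
`x` if the `n`-th largest flight exceeds `x`, and fewer than `n` do if it is below `x`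
(`eventually_le_gridCount_of_lt`, `eventually_gridCount_lt_of_lt`). The increments are independent
copies of `L (t / m)`, and the Laplace representation gives `m P(L (t / m) ≥ x) → t x ^ (-α)`
(`tendsto_mul_increment_tail`). The exact law of the order statistics of the increments
(`measureReal_counts`) therefore has a Poisson limit, which is the joint law of the `K + 1` largest
flights on ordered boxes (`measureReal_orderSeq_box`).

In the coordinates `w i = t X_{i+1} ^ (-α)` this law is `dw_0 ... dw_{K-1} exp(-w_K) dw_K` on `0 <
w_0 < ... < w_K`, as for the first arrival times of a rate-one Poisson process
(`IsSelfsimilarOLP.map_arrivalVec_apply`); neither `t` nor `α` survives. With `B j = a (j + 1) ^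
(-α)` the ratio conditions become `B (k-1) w_0 < w_k < B k w_0`, without upper bound for `k = K`
because `a (K + 1) = 0`. The slice at `w_0 = x` has mass `x ^ (K-1) exp(-B (K-1) x) ∏ (B (j+1) - B
j)`, and integrating over `x > 0` produces `Γ(K) (B (K-1)) ^ (-K) = Γ(K) a_K ^ (α K)` times the
product (`pi_arrivalMeasure_ratioSet`). -/

/-! ### Càdlàg paths: grid increments detect large flights -/

/-- The `i`-th point of the partition of `[0, t]` into `m` intervals of equal length. -/
noncomputable def gridPt (t : ℝ≥0) (m i : ℕ) : ℝ≥0 := i * (t / m)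

/-- The increment of `f` over the `i`-th interval of the partition of `[0, t]` into `m`
intervals. -/
noncomputable def gridInc (f : ℝ≥0 → ℝ) (t : ℝ≥0) (m i : ℕ) : ℝ :=
  f (gridPt t m (i + 1)) - f (gridPt t m i)

/-- The number of grid increments of size at least `x`. -/
noncomputable def gridCount (f : ℝ≥0 → ℝ) (t : ℝ≥0) (m : ℕ) (x : ℝ) : ℕ :=
  ((Finset.range m).filter fun i => x ≤ gridInc f t m i).card

lemma gridPt_succ (t : ℝ≥0) (m i : ℕ) : gridPt t m (i + 1) = gridPt t m i + t / m := by
  simp [gridPt]; ring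

lemma gridPt_mono (t : ℝ≥0) (m : ℕ) : Monotone (gridPt t m) := by
  intro i j h
  unfold gridPt
  gcongr

lemma gridPt_le {t : ℝ≥0} {m i : ℕ} (h : i ≤ m) : gridPt t m i ≤ t := by
  rcases Nat.eq_zero_or_pos m with rfl | hm
  · simp [gridPt]
  · have h1 : gridPt t m m = t := by
      have : (m : ℝ≥0) ≠ 0 := by positivity
      unfold gridPt; field_simp
    exact (gridPt_mono t m h).trans h1.le

lemma tendsto_mesh (t : ℝ≥0) : Tendsto (fun m : ℕ => t / (m : ℝ≥0)) atTop (𝓝 0) :=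
  tendsto_const_div_atTop_nhds_zero_nat t

lemma flight_zero (f : ℝ≥0 → ℝ) : flight f 0 = 0 := by
  have h : IsBot (0 : ℝ≥0) := fun _ => zero_le
  simp [flight, leftLim_eq_of_isBot h]

namespace IsCadlagPath

variable {f : ℝ≥0 → ℝ}

lemma tendsto_left (hf : IsCadlagPath f) (s : ℝ≥0) :
    Tendsto f (𝓝[<] s) (𝓝 (Function.leftLim f s)) :=
  tendsto_leftLim_of_tendsto (hf s).2

/-- Along an ultrafilter each endpoint stays eventually on one side of `s`. Endpoints on the same
side share a one-sided limit, so only intervals straddling `s` see the flight. The ultrafilter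
replaces repeated passage to subsequences. -/
lemma tendsto_sub_ultrafilter (hf : IsCadlagPath f) {ι : Type*} (U : Ultrafilter ι)
    {u v : ι → ℝ≥0} {s : ℝ≥0} (hu : Tendsto u U (𝓝 s)) (hv : Tendsto v U (𝓝 s))
    (huv : ∀ i, u i ≤ v i) :
    Tendsto (fun i => f (v i) - f (u i)) U (𝓝 0) ∨
      ((∀ᶠ i in U, u i < s ∧ s ≤ v i) ∧
        Tendsto (fun i => f (v i) - f (u i)) U (𝓝 (flight f s))) := by
  have left : ∀ w : ι → ℝ≥0, Tendsto w U (𝓝 s) → (∀ᶠ i in U, w i < s) →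
      Tendsto (fun i => f (w i)) U (𝓝 (Function.leftLim f s)) := fun w hw h =>
    (hf.tendsto_left s).comp (tendsto_nhdsWithin_iff.2 ⟨hw, h⟩)
  have right : ∀ w : ι → ℝ≥0, Tendsto w U (𝓝 s) → (∀ᶠ i in U, s ≤ w i) →
      Tendsto (fun i => f (w i)) U (𝓝 (f s)) := fun w hw h =>
    (hf s).1.tendsto.comp (tendsto_nhdsWithin_iff.2 ⟨hw, h⟩)
  rcases U.em (fun i => u i < s) with h1 | h1
  · rcases U.em (fun i => v i < s) with h2 | h2
    · left
      simpa using (left v hv h2).sub (left u hu h1)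
    · right
      have h2' : ∀ᶠ i in U, s ≤ v i := h2.mono fun i hi => not_lt.1 hi
      exact ⟨h1.and h2', (right v hv h2').sub (left u hu h1)⟩
  · left
    have h1' : ∀ᶠ i in U, s ≤ u i := h1.mono fun i hi => not_lt.1 hi
    have h2' : ∀ᶠ i in U, s ≤ v i := h1'.mono fun i hi => hi.trans (huv i)
    simpa using (right v hv h2').sub (right u hu h1')

/-- Unbounded flights would give pairs of times ever closer together with increments tending to
infinity; by compactness they cluster at one point, where increments have a finite limit. The bound
matters because `sSup` of an unbounded set is `0`. -/
lemma bddAbove_flight (hf : IsCadlagPath f) (t : ℝ≥0) :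
    BddAbove (flight f '' Set.Iic t) := by
  by_contra hb
  have h : ∀ n : ℕ, ∃ s u : ℝ≥0, s ≤ t ∧ u ≤ s ∧ dist u s < 1 / (n + 1 : ℝ) ∧
      (n : ℝ) ≤ f s - f u := by
    intro n
    obtain ⟨_, ⟨s, hs, rfl⟩, hs'⟩ := not_bddAbove_iff.1 hb n
    have hs0 : s ≠ 0 := by
      rintro rfl
      rw [flight_zero] at hs'
      exact absurd hs' (by simp)
    have : (𝓝[<] s).NeBot := nhdsLT_neBot_of_exists_lt ⟨0, pos_iff_ne_zero.2 hs0⟩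
    have h1 : ∀ᶠ u in 𝓝[<] s, (n : ℝ) < f s - f u :=
      (tendsto_const_nhds.sub (hf.tendsto_left s)).eventually_const_lt hs'
    have h2 : ∀ᶠ u in 𝓝[<] s, dist u s < 1 / (n + 1 : ℝ) :=
      nhdsWithin_le_nhds (Metric.ball_mem_nhds s (by positivity))
    obtain ⟨u, h3, h4, h5⟩ := (h1.and (h2.and self_mem_nhdsWithin)).exists
    exact ⟨s, u, hs, le_of_lt h5, h4, h3.le⟩
  choose v u hvt huv hd hfn using h
  let U : Ultrafilter ℕ := Ultrafilter.of atTop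
  have hU : (U : Filter ℕ) ≤ atTop := Ultrafilter.of_le _
  obtain ⟨s, -, hs⟩ := (isCompact_Icc (a := (0 : ℝ≥0)) (b := t)).ultrafilter_le_nhds (U.map v)
    (by
      rw [le_principal_iff]
      exact Filter.Eventually.of_forall (f := (U : Filter ℕ)) fun n => ⟨zero_le, hvt n⟩)
  have hv : Tendsto v U (𝓝 s) := hs
  have hu : Tendsto u U (𝓝 s) := by
    have h0 : Tendsto (fun n => dist (u n) (v n)) atTop (𝓝 0) :=
      squeeze_zero (fun _ => dist_nonneg) (fun n => (hd n).le)
        tendsto_one_div_add_atTop_nhds_zero_nat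
    exact (tendsto_iff_of_dist (h0.mono_left hU)).2 hv
  have htop : Tendsto (fun n => f (v n) - f (u n)) U atTop :=
    (tendsto_atTop_mono hfn tendsto_natCast_atTop_atTop).mono_left hU
  rcases hf.tendsto_sub_ultrafilter U hu hv huv with h | ⟨-, h⟩ <;>
  exact not_tendsto_nhds_of_tendsto_atTop htop _ h

/-- Otherwise, for arbitrarily fine grids, some cell with a large increment contains no large
flight. By compactness such cells shrink to a point `s`, and their increments tend to `0` or to the
flight at `s`. The first is impossible since `x > 0`; in the second `s` is itself a large flight
lying in the cell. -/
lemma eventually_gridCount_lt (hf : IsCadlagPath f) {t : ℝ≥0} {x : ℝ} (hx : 0 < x) {n : ℕ}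
    (hn : Set.encard {s : ℝ≥0 | s ≤ t ∧ x ≤ flight f s} < n) :
    ∀ᶠ m in atTop, gridCount f t m x < n := by
  set F := {s : ℝ≥0 | s ≤ t ∧ x ≤ flight f s} with hF
  have hFfin : F.Finite := Set.finite_of_encard_le_coe hn.le
  by_contra hcon
  have hcon' : ∃ᶠ m in atTop, ∃ i : ℕ, i < m ∧ x ≤ gridInc f t m i ∧
      ∀ s ∈ F, ¬ (gridPt t m i < s ∧ s ≤ gridPt t m (i + 1)) := by
    -- Pigeonhole: if every large increment had a large flight in its cell, disjointness of the
    -- half-open cells would inject the large increments into `F`.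
    refine Filter.Frequently.mono (p := fun m => ¬ gridCount f t m x < n) (not_eventually.1 hcon) ?_
    intro m hm
    by_contra! hno
    apply hm
    choose! g hgF hg using hno
    have hinj : Set.InjOn g ((Finset.range m).filter fun i => x ≤ gridInc f t m i) := by
      intro i hi j hj hij
      simp only [Finset.coe_filter, Finset.mem_range, Set.mem_ofPred_eq] at hi hj
      have h1 := hg i hi.1 hi.2
      have h2 := hg j hj.1 hj.2
      rw [hij] at h1
      rcases lt_trichotomy i j with h | h | h
      · exact absurd (h1.2.trans (gridPt_mono t m h)) (not_le.2 h2.1)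
      · exact h
      · exact absurd (h2.2.trans (gridPt_mono t m h)) (not_le.2 h1.1)
    have h3 := Set.encard_le_encard_of_injOn (t := F) (f := g) (by
      intro i hi
      simp only [Finset.coe_filter, Finset.mem_range, Set.mem_ofPred_eq] at hi
      exact hgF i hi.1 hi.2) hinj
    rw [Set.encard_coe_eq_coe_finsetCard] at h3
    exact_mod_cast h3.trans_lt hn
  have hne : (atTop ⊓ 𝓟 {m | ∃ i : ℕ, i < m ∧ x ≤ gridInc f t m i ∧
      ∀ s ∈ F, ¬ (gridPt t m i < s ∧ s ≤ gridPt t m (i + 1))}).NeBot :=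
    frequently_mem_iff_neBot.1 hcon'
  let U := Ultrafilter.of (atTop ⊓ 𝓟 {m | ∃ i : ℕ, i < m ∧ x ≤ gridInc f t m i ∧
      ∀ s ∈ F, ¬ (gridPt t m i < s ∧ s ≤ gridPt t m (i + 1))})
  have hU := Ultrafilter.of_le (atTop ⊓ 𝓟 {m | ∃ i : ℕ, i < m ∧ x ≤ gridInc f t m i ∧
      ∀ s ∈ F, ¬ (gridPt t m i < s ∧ s ≤ gridPt t m (i + 1))})
  have hUtop : (U : Filter ℕ) ≤ atTop := hU.trans inf_le_left
  have hUbad := le_principal_iff.1 (hU.trans inf_le_right)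
  have hch : ∀ m : ℕ, ∃ i : ℕ, (∃ i : ℕ, i < m ∧ x ≤ gridInc f t m i ∧
      ∀ s ∈ F, ¬ (gridPt t m i < s ∧ s ≤ gridPt t m (i + 1))) → (i < m ∧ x ≤ gridInc f t m i ∧
      ∀ s ∈ F, ¬ (gridPt t m i < s ∧ s ≤ gridPt t m (i + 1))) := by
    intro m
    by_cases h : ∃ i : ℕ, i < m ∧ x ≤ gridInc f t m i ∧
      ∀ s ∈ F, ¬ (gridPt t m i < s ∧ s ≤ gridPt t m (i + 1))
    · obtain ⟨i, hi⟩ := h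
      exact ⟨i, fun _ => hi⟩
    · exact ⟨0, fun h' => absurd h' h⟩
  choose I hI using hch
  have hI' : ∀ᶠ m in U, I m < m ∧ x ≤ gridInc f t m (I m) ∧
      ∀ s ∈ F, ¬ (gridPt t m (I m) < s ∧ s ≤ gridPt t m (I m + 1)) := by
    filter_upwards [hUbad] with m hm using hI m hm
  obtain ⟨s, hst, hs⟩ := (isCompact_Icc (a := (0 : ℝ≥0)) (b := t)).ultrafilter_le_nhds
    (U.map fun m => gridPt t m (I m)) (by
      rw [le_principal_iff]
      change ∀ᶠ m in U, gridPt t m (I m) ∈ Set.Icc 0 t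
      filter_upwards [hI'] with m hm using ⟨zero_le, gridPt_le hm.1.le⟩)
  have hu : Tendsto (fun m => gridPt t m (I m)) U (𝓝 s) := hs
  have hv : Tendsto (fun m => gridPt t m (I m + 1)) U (𝓝 s) := by
    simp only [gridPt_succ]
    simpa using hu.add ((tendsto_mesh t).mono_left hUtop)
  rcases hf.tendsto_sub_ultrafilter U hu hv (fun m => gridPt_mono t m (Nat.le_succ _)) with
    h | ⟨hin, h⟩
  · exact absurd (ge_of_tendsto h (hI'.mono fun m hm => hm.2.1)) (not_le.2 hx)
  · have hsF : s ∈ F := ⟨hst.2, ge_of_tendsto h (hI'.mono fun m hm => hm.2.1)⟩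
    obtain ⟨m, hm1, hm2⟩ := (hI'.and hin).exists
    exact hm1.2.2 s hsF hm2

lemma exists_grid_cell {t : ℝ≥0} (m : ℕ) {s : ℝ≥0} (hs0 : 0 < s) (hst : s ≤ t) (hm : 0 < m) :
    ∃ i < m, gridPt t m i < s ∧ s ≤ gridPt t m (i + 1) := by
  have ht : 0 < t := hs0.trans_le hst
  have hm' : (0 : ℝ≥0) < m := by exact_mod_cast hm
  have hd : 0 < t / (m : ℝ≥0) := by positivity
  have hex : ∃ j, s ≤ gridPt t m j := ⟨m, by
    have : (m : ℝ≥0) ≠ 0 := hm'.ne'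
    unfold gridPt
    field_simp
    exact hst⟩
  classical
  have h1 := Nat.find_spec hex
  have h0 : Nat.find hex ≠ 0 := by
    intro h
    rw [h] at h1
    simp [gridPt] at h1
    exact hs0.ne' h1
  obtain ⟨i, hi⟩ := Nat.exists_eq_succ_of_ne_zero h0
  rw [hi] at h1
  refine ⟨i, ?_, not_le.1 (Nat.find_min hex (by omega)), h1⟩
  have h2 : gridPt t m i < t := (not_le.1 (Nat.find_min hex (m := i) (by omega))).trans_le hst
  by_contra hmi
  have h3 := gridPt_mono t m (not_lt.1 hmi)
  have h4 : gridPt t m m = t := by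
    have : (m : ℝ≥0) ≠ 0 := hm'.ne'
    unfold gridPt; field_simp
  exact absurd (h4.ge.trans h3) (not_le.2 h2)

/-- Pick `n` flights of size at least `y`. The increments over the cells containing them converge to
these flights, and the gap `x < y` absorbs the error. Cells are open on the left, so the left
endpoint approaches strictly from below, as the left limit requires. -/
lemma eventually_le_gridCount (hf : IsCadlagPath f) {t : ℝ≥0} {x y : ℝ} (hx : 0 < x)
    (hxy : x < y) {n : ℕ} (hn : (n : ℕ∞) ≤ Set.encard {s : ℝ≥0 | s ≤ t ∧ y ≤ flight f s}) :
    ∀ᶠ m in atTop, n ≤ gridCount f t m x := by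
  obtain ⟨S, hSsub, hScard⟩ := Set.exists_subset_encard_eq hn
  have hSfin : S.Finite := Set.finite_of_encard_eq_coe hScard
  have hpos : ∀ s ∈ S, 0 < s := by
    intro s hs
    rw [pos_iff_ne_zero]
    rintro rfl
    have := (hSsub hs).2
    rw [flight_zero] at this
    linarith
  have hcell : ∀ m : ℕ, ∀ s : ℝ≥0, ∃ i : ℕ, s ∈ S → 0 < m →
      (i < m ∧ gridPt t m i < s ∧ s ≤ gridPt t m (i + 1)) := by
    intro m s
    by_cases h : s ∈ S ∧ 0 < m
    · obtain ⟨i, hi⟩ := exists_grid_cell m (hpos s h.1) (hSsub h.1).1 h.2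
      exact ⟨i, fun _ _ => hi⟩
    · exact ⟨0, fun h1 h2 => absurd ⟨h1, h2⟩ h⟩
  choose c hc using hcell
  have hv : ∀ s ∈ S, Tendsto (fun m => gridPt t m (c m s + 1)) atTop (𝓝[≥] s) := by
    intro s hs
    refine tendsto_nhdsWithin_iff.2 ⟨?_, ?_⟩
    · refine tendsto_of_tendsto_of_tendsto_of_le_of_le' tendsto_const_nhds
        (h := fun m : ℕ => s + t / (m : ℝ≥0)) ?_ ?_ ?_
      · simpa using tendsto_const_nhds.add (tendsto_mesh t)
      · filter_upwards [eventually_gt_atTop 0] with m hm using (hc m s hs hm).2.2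
      · filter_upwards [eventually_gt_atTop 0] with m hm
        rw [gridPt_succ]
        exact add_le_add_left (hc m s hs hm).2.1.le _
    · filter_upwards [eventually_gt_atTop 0] with m hm using (hc m s hs hm).2.2
  have hu : ∀ s ∈ S, Tendsto (fun m => gridPt t m (c m s)) atTop (𝓝[<] s) := by
    intro s hs
    refine tendsto_nhdsWithin_iff.2 ⟨?_, ?_⟩
    · refine tendsto_of_tendsto_of_tendsto_of_le_of_le' 
        (g := fun m : ℕ => s - t / (m : ℝ≥0)) ?_ tendsto_const_nhds ?_ ?_
      · simpa using tendsto_const_nhds.sub (tendsto_mesh t)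
      · filter_upwards [eventually_gt_atTop 0] with m hm
        rw [tsub_le_iff_right, ← gridPt_succ]
        exact (hc m s hs hm).2.2
      · filter_upwards [eventually_gt_atTop 0] with m hm using (hc m s hs hm).2.1.le
    · filter_upwards [eventually_gt_atTop 0] with m hm using (hc m s hs hm).2.1
  have hbig : ∀ᶠ m in atTop, ∀ s ∈ S, x ≤ gridInc f t m (c m s) := by
    rw [eventually_all_finite hSfin]
    intro s hs
    have h := ((hf s).1.tendsto.comp (hv s hs)).sub ((hf.tendsto_left s).comp (hu s hs))
    exact (h.eventually_const_lt (hxy.trans_le (hSsub hs).2)).mono fun m hm => hm.le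
  -- Distinct flight times eventually occupy distinct cells, so no increment is counted twice.
  have hsep : ∀ᶠ m in atTop, ∀ s ∈ S, ∀ s' ∈ S, s < s' → gridPt t m (c m s + 1) < s' := by
    rw [eventually_all_finite hSfin]
    intro s hs
    rw [eventually_all_finite hSfin]
    intro s' hs'
    by_cases h : s < s'
    · filter_upwards [((hv s hs).mono_right nhdsWithin_le_nhds).eventually_lt_const h] with m hm _
        using hm
    · exact Eventually.of_forall fun m h' => absurd h' h
  filter_upwards [hbig, hsep, eventually_gt_atTop 0] with m h1 h2 hm
  have hinj : Set.InjOn (c m) S := by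
    intro s hs s' hs' h
    rcases lt_trichotomy s s' with hlt | heq | hlt
    · exact absurd (h ▸ h2 s hs s' hs' hlt) (not_lt.2 (hc m s' hs' hm).2.2)
    · exact heq
    · exact absurd (h ▸ h2 s' hs' s hs hlt) (not_lt.2 (hc m s hs hm).2.2)
  have h3 := Set.encard_le_encard_of_injOn
    (t := (((Finset.range m).filter fun i => x ≤ gridInc f t m i : Finset ℕ) : Set ℕ))
    (f := c m) (s := S) (by
      intro s hs
      simp only [Finset.coe_filter, Finset.mem_range, Set.mem_ofPred_eq]
      exact ⟨(hc m s hs hm).1, h1 s hs⟩) hinj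
  rw [Set.encard_coe_eq_coe_finsetCard, hScard] at h3
  exact_mod_cast h3

lemma le_nthLargestFlight (hf : IsCadlagPath f) {t : ℝ≥0} {x : ℝ} (hx : 0 < x) {n : ℕ}
    (hn1 : 1 ≤ n) (hn : (n : ℕ∞) ≤ Set.encard {s : ℝ≥0 | s ≤ t ∧ x ≤ flight f s}) :
    x ≤ nthLargestFlight f t n := by
  refine le_csSup ?_ ⟨hx, hn⟩
  obtain ⟨b, hb⟩ := hf.bddAbove_flight t
  refine ⟨b, ?_⟩
  rintro y ⟨-, hy⟩
  have h1 : (1 : ℕ∞) ≤ Set.encard {s : ℝ≥0 | s ≤ t ∧ y ≤ flight f s} :=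
    le_trans (by exact_mod_cast hn1) hy
  obtain ⟨s, hs⟩ := Set.one_le_encard_iff_nonempty.1 h1
  exact hs.2.trans (hb ⟨s, hs.1, rfl⟩)

/-- If the `n`-th largest flight exceeds `x`, so do `n` increments over each fine grid. -/
lemma eventually_le_gridCount_of_lt (hf : IsCadlagPath f) {t : ℝ≥0} {x : ℝ} (hx : 0 < x) {n : ℕ}
    (h : x < nthLargestFlight f t n) : ∀ᶠ m in atTop, n ≤ gridCount f t m x := by
  -- An empty set would have `sSup` equal to `0`, which is not above `x`.
  have hne : {x : ℝ | 0 < x ∧ (n : ℕ∞) ≤ Set.encard {s : ℝ≥0 | s ≤ t ∧ x ≤ flight f s}}.Nonempty := by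
    by_contra hemp
    rw [Set.not_nonempty_iff_eq_empty] at hemp
    rw [nthLargestFlight, hemp, Real.sSup_empty] at h
    exact absurd h (not_lt.2 hx.le)
  obtain ⟨y, ⟨-, hy⟩, hxy⟩ := exists_lt_of_lt_csSup hne h
  exact hf.eventually_le_gridCount hx hxy hy

/-- If the `n`-th largest flight is below `x`, fine grids have fewer than `n` increments of size
at least `x`. -/
lemma eventually_gridCount_lt_of_lt (hf : IsCadlagPath f) {t : ℝ≥0} {x : ℝ} (hx : 0 < x) {n : ℕ}
    (hn1 : 1 ≤ n) (h : nthLargestFlight f t n < x) : ∀ᶠ m in atTop, gridCount f t m x < n := by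
  refine hf.eventually_gridCount_lt hx ?_
  by_contra hcon
  exact absurd (hf.le_nthLargestFlight hx hn1 (not_lt.1 hcon)) (not_le.2 h)

end IsCadlagPath

lemma nthLargestFlight_nonneg (f : ℝ≥0 → ℝ) (t : ℝ≥0) (n : ℕ) : 0 ≤ nthLargestFlight f t n :=
  Real.sSup_nonneg fun _ hx => hx.1.le

/-! ### Convergence of tails from convergence of Laplace exponents -/

section LaplaceTails

/-- Measures on `[0, ∞)` for which `1 - exp (-x)` is integrable. -/
structure IsLaplaceMeasure (κ : Measure ℝ) : Prop where
  nonneg : ∀ᵐ x ∂κ, 0 ≤ x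
  integrable : Integrable (fun x => 1 - Real.exp (-x)) κ

variable {κ : Measure ℝ}

lemma IsLaplaceMeasure.integrable_mul (hκ : IsLaplaceMeasure κ) {h : ℝ → ℝ} (hh : Continuous h) :
    Integrable (fun x => (1 - Real.exp (-x)) * h (Real.exp (-x))) κ := by
  obtain ⟨C, hC⟩ := (isCompact_Icc (a := (0 : ℝ)) (b := 1)).exists_bound_of_continuousOn
    hh.continuousOn
  refine hκ.integrable.mul_bdd (c := C) (by fun_prop) ?_
  filter_upwards [hκ.nonneg] with x hx
  exact hC _ ⟨(Real.exp_pos _).le, Real.exp_le_one_iff.2 (by linarith)⟩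

lemma IsLaplaceMeasure.abs_integral_sub_le (hκ : IsLaplaceMeasure κ) {h p : ℝ → ℝ}
    (hh : Continuous h) (hp : Continuous p) {ε : ℝ} (hε : ∀ y ∈ Set.Icc (0 : ℝ) 1, |p y - h y| ≤ ε) :
    |(∫ x, (1 - Real.exp (-x)) * p (Real.exp (-x)) ∂κ) -
      ∫ x, (1 - Real.exp (-x)) * h (Real.exp (-x)) ∂κ| ≤ ε * ∫ x, (1 - Real.exp (-x)) ∂κ := by
  rw [← integral_sub (hκ.integrable_mul hp) (hκ.integrable_mul hh), ← integral_const_mul,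
    ← Real.norm_eq_abs]
  refine norm_integral_le_of_norm_le (hκ.integrable.const_mul ε) ?_
  filter_upwards [hκ.nonneg] with x hx
  have h1 : Real.exp (-x) ≤ 1 := Real.exp_le_one_iff.2 (by linarith)
  rw [← mul_sub, norm_mul, Real.norm_eq_abs, Real.norm_eq_abs, abs_of_nonneg (by linarith),
    mul_comm]
  exact mul_le_mul_of_nonneg_right (hε _ ⟨(Real.exp_pos _).le, h1⟩) (by linarith)

lemma IsLaplaceMeasure.integrable_one_sub_exp (hκ : IsLaplaceMeasure κ) (k : ℕ) :
    Integrable (fun x => 1 - Real.exp (-(k * x))) κ := by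
  have h := hκ.integrable_mul (h := fun y => ∑ i ∈ Finset.range k, y ^ i) (by fun_prop)
  refine h.congr (Eventually.of_forall fun x => ?_)
  simp only
  rw [mul_neg_geom_sum, ← Real.exp_nat_mul]
  ring_nf

variable {κs : ℕ → Measure ℝ}

/-- In the variable `y = exp (-x)`, the integral of `(1 - y) y ^ n` is a difference of two Laplace
exponents, so polynomials `h` are covered; Weierstrass approximation on `[0, 1]` gives the rest. The
weight `1 - y` has finite integral even when `κ` has infinite mass near `0`. -/
lemma tendsto_integral_of_tendsto_laplace (hκ : IsLaplaceMeasure κ)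
    (hκs : ∀ m, IsLaplaceMeasure (κs m))
    (hlim : ∀ k : ℕ, Tendsto (fun m => ∫ x, (1 - Real.exp (-(k * x))) ∂(κs m)) atTop
      (𝓝 (∫ x, (1 - Real.exp (-(k * x))) ∂κ)))
    {h : ℝ → ℝ} (hh : Continuous h) :
    Tendsto (fun m => ∫ x, (1 - Real.exp (-x)) * h (Real.exp (-x)) ∂(κs m)) atTop
      (𝓝 (∫ x, (1 - Real.exp (-x)) * h (Real.exp (-x)) ∂κ)) := by
  have hpoly : ∀ p : Polynomial ℝ,
      Tendsto (fun m => ∫ x, (1 - Real.exp (-x)) * p.eval (Real.exp (-x)) ∂(κs m)) atTop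
        (𝓝 (∫ x, (1 - Real.exp (-x)) * p.eval (Real.exp (-x)) ∂κ)) := by
    intro p
    induction p using Polynomial.induction_on' with
    | add p q hp hq =>
      have key : ∀ κ' : Measure ℝ, IsLaplaceMeasure κ' →
          ∫ x, (1 - Real.exp (-x)) * (p + q).eval (Real.exp (-x)) ∂κ' =
            (∫ x, (1 - Real.exp (-x)) * p.eval (Real.exp (-x)) ∂κ') +
              ∫ x, (1 - Real.exp (-x)) * q.eval (Real.exp (-x)) ∂κ' := by
        intro κ' h'
        rw [← integral_add (h'.integrable_mul p.continuous) (h'.integrable_mul q.continuous)]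
        congr with x
        simp [mul_add]
      simp_rw [key _ hκ, fun m => key _ (hκs m)]
      exact hp.add hq
    | monomial n a =>
      have key : ∀ κ' : Measure ℝ, IsLaplaceMeasure κ' →
          ∫ x, (1 - Real.exp (-x)) * (Polynomial.monomial n a).eval (Real.exp (-x)) ∂κ' =
            a * ((∫ x, (1 - Real.exp (-((n + 1 : ℕ) * x))) ∂κ') -
              ∫ x, (1 - Real.exp (-(n * x))) ∂κ') := by
        intro κ' h'
        rw [← integral_sub (h'.integrable_one_sub_exp _) (h'.integrable_one_sub_exp _),
          ← integral_const_mul]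
        congr with x
        have h1 : Real.exp (-((n + 1 : ℕ) * x)) = Real.exp (-x) ^ (n + 1) := by
          rw [← Real.exp_nat_mul]; ring_nf
        have h2 : Real.exp (-(n * x)) = Real.exp (-x) ^ n := by
          rw [← Real.exp_nat_mul]; ring_nf
        rw [Polynomial.eval_monomial, h1, h2]
        ring
      simp_rw [key _ hκ, fun m => key _ (hκs m)]
      exact ((hlim _).sub (hlim _)).const_mul a
  have hone : Tendsto (fun m => ∫ x, (1 - Real.exp (-x)) ∂(κs m)) atTop
      (𝓝 (∫ x, (1 - Real.exp (-x)) ∂κ)) := by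
    simpa using hlim 1
  set M := ∫ x, (1 - Real.exp (-x)) ∂κ with hM
  have hM0 : 0 ≤ M := by
    refine integral_nonneg_of_ae ?_
    filter_upwards [hκ.nonneg] with x hx
    have h1 : Real.exp (-x) ≤ 1 := Real.exp_le_one_iff.2 (by linarith)
    simpa using h1
  rw [Metric.tendsto_atTop']
  intro ε hε
  -- The approximation errors are at most `δ (M + 1)` for `κs m` and `δ M` for `κ`; the polynomial
  -- integrals differ by less than `δ`. The total is `δ (2 M + 2)`.
  set δ := ε / (2 * M + 2) with hδ
  have hδ0 : 0 < δ := by positivity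
  obtain ⟨p, hp⟩ := exists_polynomial_near_of_continuousOn 0 1 h hh.continuousOn δ hδ0
  have hp' : ∀ y ∈ Set.Icc (0 : ℝ) 1, |p.eval y - h y| ≤ δ := fun y hy => (hp y hy).le
  have e1 : ∀ᶠ m in atTop, ∫ x, (1 - Real.exp (-x)) ∂(κs m) < M + 1 :=
    hone.eventually_lt_const (by linarith)
  have e2 := Metric.tendsto_nhds.1 (hpoly p) δ hδ0
  obtain ⟨N, hN⟩ := (e1.and e2).exists_forall_of_atTop
  refine ⟨N, fun m hm => ?_⟩
  obtain ⟨h1, h2⟩ := hN m hm.le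
  have h3 := hκ.abs_integral_sub_le hh p.continuous hp'
  have h4 := (hκs m).abs_integral_sub_le hh p.continuous hp'
  have h5 : δ * ∫ x, (1 - Real.exp (-x)) ∂(κs m) < δ * (M + 1) :=
    mul_lt_mul_of_pos_left h1 hδ0
  have h6 : δ * (2 * M + 2) = ε := by rw [hδ]; field_simp
  rw [Real.dist_eq] at h2 ⊢
  rw [abs_lt] at h2 ⊢
  rw [abs_le] at h3 h4
  constructor <;> nlinarith [h2.1, h2.2, h3.1, h3.2, h4.1, h4.2]

/-- A continuous approximation, between levels `a < b`, of the indicator of `(x, ∞)` divided by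
`1 - exp (-x)`, in the variable `y = exp (-x)`. -/
noncomputable def rampQuotient (a b y : ℝ) : ℝ :=
  min 1 (max 0 ((Real.exp (-a) - y) / (Real.exp (-a) - Real.exp (-b)))) /
    max (1 - y) (1 - Real.exp (-a))

lemma continuous_rampQuotient {a : ℝ} (b : ℝ) (ha : 0 < a) : Continuous (rampQuotient a b) := by
  unfold rampQuotient
  refine Continuous.div (by fun_prop) (by fun_prop) fun y => ne_of_gt ?_
  exact lt_max_of_lt_right (by simpa using ha)

lemma mul_rampQuotient_le {a b x : ℝ} (ha : 0 < a) (hab : a < b) (hx : 0 ≤ x) :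
    (1 - Real.exp (-x)) * rampQuotient a b (Real.exp (-x)) ≤
      (Set.Ioi a).indicator (fun _ => (1 : ℝ)) x := by
  have h1 : Real.exp (-x) ≤ 1 := Real.exp_le_one_iff.2 (by linarith)
  have h2 : Real.exp (-b) < Real.exp (-a) := Real.exp_lt_exp.2 (by linarith)
  have h3 : 0 < max (1 - Real.exp (-x)) (1 - Real.exp (-a)) :=
    lt_max_of_lt_right (by simpa using ha)
  unfold rampQuotient
  by_cases hxa : a < x
  · rw [Set.indicator_of_mem (show x ∈ Set.Ioi a from hxa), ← mul_div_assoc, div_le_one h3]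
    refine le_trans ?_ (le_max_left _ _)
    exact mul_le_of_le_one_right (by linarith) (min_le_left _ _)
  · rw [Set.indicator_of_notMem (show x ∉ Set.Ioi a from hxa)]
    have h4 : Real.exp (-a) ≤ Real.exp (-x) := Real.exp_le_exp.2 (by linarith)
    rw [max_eq_left (b := (Real.exp (-a) - Real.exp (-x)) / _)
      (div_nonpos_of_nonpos_of_nonneg (by linarith) (by linarith))]
    simp

lemma le_mul_rampQuotient {a b x : ℝ} (ha : 0 < a) (hab : a < b) (hx : 0 ≤ x) :
    (Set.Ici b).indicator (fun _ => (1 : ℝ)) x ≤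
      (1 - Real.exp (-x)) * rampQuotient a b (Real.exp (-x)) := by
  have h1 : Real.exp (-x) ≤ 1 := Real.exp_le_one_iff.2 (by linarith)
  have h2 : Real.exp (-b) < Real.exp (-a) := Real.exp_lt_exp.2 (by linarith)
  have h3 : 0 < max (1 - Real.exp (-x)) (1 - Real.exp (-a)) :=
    lt_max_of_lt_right (by simpa using ha)
  unfold rampQuotient
  by_cases hxb : b ≤ x
  · rw [Set.indicator_of_mem (show x ∈ Set.Ici b from hxb)]
    have h4 : Real.exp (-x) ≤ Real.exp (-b) := Real.exp_le_exp.2 (by linarith)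
    have h5 : 1 ≤ (Real.exp (-a) - Real.exp (-x)) / (Real.exp (-a) - Real.exp (-b)) := by
      rw [one_le_div (by linarith)]; linarith
    rw [max_eq_right (by linarith), min_eq_left h5, max_eq_left (by linarith),
      mul_one_div_cancel]
    have : Real.exp (-a) < 1 := by simpa using ha
    linarith
  · rw [Set.indicator_of_notMem (show x ∉ Set.Ici b from hxb)]
    have : 0 ≤ min 1 (max 0
        ((Real.exp (-a) - Real.exp (-x)) / (Real.exp (-a) - Real.exp (-b)))) :=
      le_min zero_le_one (le_max_left _ _)
    exact mul_nonneg (by linarith) (div_nonneg this h3.le)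

lemma IsLaplaceMeasure.measure_Ici_lt_top (hκ : IsLaplaceMeasure κ) {a : ℝ} (ha : 0 < a) :
    κ (Set.Ici a) < ∞ := by
  have h : 0 < 1 - Real.exp (-a) := by simpa using ha
  refine (measure_mono ?_).trans_lt (hκ.integrable.measure_ge_lt_top h)
  intro x hx
  have : Real.exp (-x) ≤ Real.exp (-a) := Real.exp_le_exp.2 (by linarith [Set.mem_Ici.1 hx])
  show 1 - Real.exp (-a) ≤ 1 - Real.exp (-x)
  linarith

lemma IsLaplaceMeasure.integral_ramp_le (hκ : IsLaplaceMeasure κ) {a b : ℝ} (ha : 0 < a)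
    (hab : a < b) :
    ∫ x, (1 - Real.exp (-x)) * rampQuotient a b (Real.exp (-x)) ∂κ ≤ κ.real (Set.Ioi a) := by
  have hfin : κ (Set.Ioi a) < ∞ :=
    (measure_mono Set.Ioi_subset_Ici_self).trans_lt (hκ.measure_Ici_lt_top ha)
  rw [← integral_indicator_one measurableSet_Ioi]
  refine integral_mono_ae (hκ.integrable_mul (continuous_rampQuotient b ha))
    ((integrable_indicator_iff measurableSet_Ioi).2 (integrableOn_const hfin.ne)) ?_
  filter_upwards [hκ.nonneg] with x hx using mul_rampQuotient_le ha hab hx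

lemma IsLaplaceMeasure.le_integral_ramp (hκ : IsLaplaceMeasure κ) {a b : ℝ} (ha : 0 < a)
    (hab : a < b) :
    κ.real (Set.Ici b) ≤ ∫ x, (1 - Real.exp (-x)) * rampQuotient a b (Real.exp (-x)) ∂κ := by
  have hfin := hκ.measure_Ici_lt_top (ha.trans hab)
  rw [← integral_indicator_one measurableSet_Ici]
  refine integral_mono_ae ((integrable_indicator_iff measurableSet_Ici).2
    (integrableOn_const hfin.ne)) (hκ.integrable_mul (continuous_rampQuotient b ha)) ?_
  filter_upwards [hκ.nonneg] with x hx using le_mul_rampQuotient ha hab hx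

/-- Convergence of Laplace transforms implies convergence of the tails, if the limiting tail is
continuous. -/
lemma tendsto_tail_of_tendsto_laplace (hκ : IsLaplaceMeasure κ)
    (hκs : ∀ m, IsLaplaceMeasure (κs m))
    (hlim : ∀ k : ℕ, Tendsto (fun m => ∫ x, (1 - Real.exp (-(k * x))) ∂(κs m)) atTop
      (𝓝 (∫ x, (1 - Real.exp (-(k * x))) ∂κ)))
    {g : ℝ → ℝ} (hg : ∀ x, 0 < x → κ.real (Set.Ioi x) = g x) {x : ℝ} (hx : 0 < x)
    (hgx : ContinuousAt g x) :
    Tendsto (fun m => (κs m).real (Set.Ici x)) atTop (𝓝 (g x)) := by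
  rw [tendsto_order]
  constructor
  · intro q hq
    -- The ramp between `x` and `b` lies between the indicators of the tails at `b` and at `x`;
    -- continuity of `g` lets `b` be taken close to `x`. The upper bound uses a ramp ending at `x`.
    have h1 : ∀ᶠ b in 𝓝[>] x, q < g b :=
      nhdsWithin_le_nhds (hgx.eventually (lt_mem_nhds hq))
    obtain ⟨b, hqb, hxb⟩ := (h1.and self_mem_nhdsWithin).exists
    have hxb : x < b := hxb
    have h2 := tendsto_integral_of_tendsto_laplace hκ hκs hlim (continuous_rampQuotient b hx)
    have h3 : q < ∫ y, (1 - Real.exp (-y)) * rampQuotient x b (Real.exp (-y)) ∂κ := by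
      refine lt_of_lt_of_le ?_ (hκ.le_integral_ramp hx hxb)
      refine hqb.trans_le ((hg b (hx.trans hxb)).symm.le.trans ?_)
      exact measureReal_mono Set.Ioi_subset_Ici_self (hκ.measure_Ici_lt_top (hx.trans hxb)).ne
    filter_upwards [h2.eventually_const_lt h3] with m hm
    refine hm.trans_le (((hκs m).integral_ramp_le hx hxb).trans ?_)
    exact measureReal_mono Set.Ioi_subset_Ici_self ((hκs m).measure_Ici_lt_top hx).ne
  · intro q hq
    have h1 : ∀ᶠ a in 𝓝[<] x, g a < q :=
      nhdsWithin_le_nhds (hgx.eventually (gt_mem_nhds hq))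
    have h0 : ∀ᶠ a in 𝓝[<] x, 0 < a := nhdsWithin_le_nhds (lt_mem_nhds hx)
    obtain ⟨a, ⟨hqa, ha⟩, hxa⟩ := ((h1.and h0).and self_mem_nhdsWithin).exists
    have hxa : a < x := hxa
    have h2 := tendsto_integral_of_tendsto_laplace hκ hκs hlim (continuous_rampQuotient x ha)
    have h3 : ∫ y, (1 - Real.exp (-y)) * rampQuotient a x (Real.exp (-y)) ∂κ < q :=
      (hκ.integral_ramp_le ha hxa).trans_lt (by rwa [hg a ha])
    filter_upwards [h2.eventually_lt_const h3] with m hm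
    exact ((hκs m).le_integral_ramp ha hxa).trans_lt hm

end LaplaceTails

/-! ### Small-time tail of the increments -/

/-- `m P(L(t/m) ≥ x) → t g(x)` for a one-sided Lévy process with continuous flight tail `g`. -/
lemma tendsto_mul_increment_tail {Ω : Type*} [MeasurableSpace Ω] {P : Measure Ω}
    [IsProbabilityMeasure P] {L : ℝ≥0 → Ω → ℝ} (hL : IsOneSidedLevyProcess L P) {ν : Measure ℝ}
    (hν : IsOneSidedLevyMeasure ν) (hLν : HasLevyMeasure L P ν) {g : ℝ → ℝ}
    (hg : ∀ x, 0 < x → flightTail ν x = ENNReal.ofReal (g x)) (hg0 : ∀ x, 0 < x → 0 ≤ g x)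
    (t : ℝ≥0) {x : ℝ} (hx : 0 < x) (hgx : ContinuousAt g x) :
    Tendsto (fun m : ℕ => m * P.real {ω | x ≤ L (t / m) ω}) atTop (𝓝 (t * g x)) := by
  have hν0 : ∀ᵐ y ∂ν, 0 ≤ y := by
    rw [ae_iff]
    exact measure_mono_null (fun y hy => (not_le.1 hy).le) hν.carried
  have hνint : Integrable (fun y => 1 - Real.exp (-y)) ν := by
    have h1 : Integrable (fun y : ℝ => min y 1) ν := by
      refine ⟨by fun_prop, ?_⟩
      rw [hasFiniteIntegral_iff_ofReal]
      · exact hν.integrability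
      · filter_upwards [hν0] with y hy using le_min hy zero_le_one
    refine h1.mono' (by fun_prop) ?_
    filter_upwards [hν0] with y hy
    have h2 : Real.exp (-y) ≤ 1 := Real.exp_le_one_iff.2 (by linarith)
    rw [Real.norm_eq_abs, abs_of_nonneg (by linarith)]
    exact le_min (by linarith [Real.add_one_le_exp (-y)]) (by linarith [Real.exp_pos (-y)])
  have hLnn : ∀ s, ∀ᵐ ω ∂P, 0 ≤ L s ω := by
    intro s
    filter_upwards [hL.start_zero, hL.nonneg_increments 0 s zero_le] with ω h0 h1
    linarith
  -- These multiples of the increment laws approximate `t • ν` away from `0`: their Laplace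
  -- exponents `m (1 - exp (-Ψ(k) t / m))` tend to `t Ψ(k)`.
  let κs : ℕ → Measure ℝ := fun m => (m : ℝ≥0) • P.map (L (t / m))
  let κ : Measure ℝ := t • ν
  have hmap : ∀ s, IsProbabilityMeasure (P.map (L s)) := fun s =>
    Measure.isProbabilityMeasure_map (hL.measurable s).aemeasurable
  have hκ : IsLaplaceMeasure κ :=
    ⟨Measure.ae_smul_measure hν0 t, hνint.smul_measure_nnreal⟩
  have hmapnn : ∀ s, ∀ᵐ y ∂(P.map (L s)), 0 ≤ y := fun s =>
    (ae_map_iff (hL.measurable s).aemeasurable measurableSet_Ici).2 (hLnn s)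
  have hexp : ∀ s (k : ℕ), Integrable (fun y => Real.exp (-(k * y))) (P.map (L s)) := by
    intro s k
    refine Integrable.of_bound (by fun_prop) 1 ?_
    filter_upwards [hmapnn s] with y hy
    rw [Real.norm_eq_abs, Real.abs_exp, Real.exp_le_one_iff]
    have : 0 ≤ (k : ℝ) * y := by positivity
    linarith
  have hκs : ∀ m, IsLaplaceMeasure (κs m) := by
    intro m
    refine ⟨Measure.ae_smul_measure (hmapnn _) _, Integrable.smul_measure_nnreal ?_⟩
    have := (integrable_const (1 : ℝ)).sub (hexp (t / m) 1)
    simpa [Pi.sub_def] using this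
  have hlim : ∀ k : ℕ, Tendsto (fun m => ∫ x, (1 - Real.exp (-(k * x))) ∂(κs m)) atTop
      (𝓝 (∫ x, (1 - Real.exp (-(k * x))) ∂κ)) := by
    intro k
    have h1 : ∀ m : ℕ, ∫ x, (1 - Real.exp (-(k * x))) ∂(κs m) =
        m * (1 - Real.exp (-(levyCharacteristic ν k * ((t / m : ℝ≥0) : ℝ)))) := by
      intro m
      have h : ∫ x, Real.exp (-(k * x)) ∂(P.map (L (t / m))) =
          ∫ ω, Real.exp (-(k * L (t / m) ω)) ∂P :=
        integral_map (hL.measurable _).aemeasurable (by fun_prop)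
      rw [integral_smul_nnreal_measure, integral_sub (integrable_const _) (hexp _ k), h,
        hLν k _ (Nat.cast_nonneg k)]
      simp [NNReal.smul_def]
    have h2 : ∫ x, (1 - Real.exp (-(k * x))) ∂κ = t * levyCharacteristic ν k := by
      rw [integral_smul_nnreal_measure]
      simp [NNReal.smul_def, levyCharacteristic]
    simp_rw [h1, h2]
    set c : ℝ := t * levyCharacteristic ν k with hc
    -- The sequence is the difference quotient of this function at `0` with step `1 / m`.
    have hd : HasDerivAt (fun y : ℝ => 1 - Real.exp (-(c * y))) c 0 := by
      have h := (((hasDerivAt_id (0 : ℝ)).const_mul c).neg.exp).const_sub 1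
      simpa using h
    have h3 := hd.tendsto_slope_zero_right.comp
      (tendsto_inv_atTop_nhdsGT_zero.comp (tendsto_natCast_atTop_atTop (R := ℝ)))
    refine h3.congr fun m => ?_
    simp only [Function.comp_apply, inv_inv, zero_add, mul_zero, neg_zero, Real.exp_zero, sub_self,
      sub_zero, smul_eq_mul, NNReal.coe_div, NNReal.coe_natCast]
    congr 4
    rw [hc]
    ring
  have h := tendsto_tail_of_tendsto_laplace (g := fun y => t * g y) hκ hκs hlim (by
    intro y hy
    simp only [κ, measureReal_nnreal_smul_apply]
    congr 1
    rw [measureReal_def, show ν (Set.Ioi y) = ENNReal.ofReal (g y) from hg y hy,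
      ENNReal.toReal_ofReal (hg0 y hy)]) hx (hgx.const_mul _)
  refine h.congr fun m => ?_
  simp only [κs, measureReal_nnreal_smul_apply]
  rw [map_measureReal_apply (hL.measurable _) measurableSet_Ici]
  simp [Set.preimage, Set.Ici]

/-! ### Order statistics of independent identically distributed variables -/

section OrderStatistics

/-- The number of indices at which `d` is at least `x`. -/
noncomputable def levelCount {ι : Type*} [Fintype ι] (d : ι → ℝ) (x : ℝ) : ℕ :=
  (Finset.univ.filter fun i => x ≤ d i).card

/-- For each `k` one entry of `d`, labelled by `k`, lies in `[l k, u k)`, and all the other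
entries are below `x`. -/
def MatchesLevels {ι : Type*} {K : ℕ} (l u : ℕ → ℝ) (x : ℝ) (d : ι → ℝ) (σ : Fin K ↪ ι) : Prop :=
  (∀ k : Fin K, d (σ k) ∈ Set.Ico (l k) (u k)) ∧ ∀ j, (∀ k, σ k ≠ j) → d j < x

variable {ι : Type*} {K : ℕ} {l u : ℕ → ℝ}

lemma upper_le_upper (hlu : ∀ i ≤ K, l i < u i) (hul : ∀ i < K, u (i + 1) ≤ l i) {i j : ℕ}
    (hij : i ≤ j) (hj : j ≤ K) : u j ≤ u i := by
  induction j, hij using Nat.le_induction with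
  | base => exact le_rfl
  | succ j hij ih =>
    exact (hul j (by omega)).trans ((hlu j (by omega)).le.trans (ih (by omega)))

lemma upper_le_lower (hlu : ∀ i ≤ K, l i < u i) (hul : ∀ i < K, u (i + 1) ≤ l i) {i j : ℕ}
    (hij : i < j) (hj : j ≤ K) : u j ≤ l i :=
  (upper_le_upper hlu hul (i := i + 1) hij hj).trans (hul i (by omega))

/-- The intervals are disjoint, so an entry determines its label; and a labelled entry is at least
`u K ≥ x`, hence cannot be unlabelled in another matching. This makes the events for different `σ`
disjoint. -/
lemma MatchesLevels.eq (hlu : ∀ i ≤ K, l i < u i) (hul : ∀ i < K, u (i + 1) ≤ l i) {x : ℝ}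
    (hx : x ≤ u K) {d : ι → ℝ} {σ σ' : Fin K ↪ ι} (h : MatchesLevels l u x d σ)
    (h' : MatchesLevels l u x d σ') : σ = σ' := by
  ext k
  by_contra hne
  have h1 := h.1 k
  have h2 : u K ≤ l k := upper_le_lower hlu hul k.2 le_rfl
  by_cases hr : ∃ k', σ' k' = σ k
  · obtain ⟨k', hk'⟩ := hr
    have h3 := h'.1 k'
    rw [hk'] at h3
    rcases lt_trichotomy (k : ℕ) k' with hlt | heq | hlt
    · linarith [upper_le_lower hlu hul hlt k'.2.le, h1.1, h3.2]
    · exact hne (by rw [← hk', Fin.ext heq])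
    · linarith [upper_le_lower hlu hul hlt k.2.le, h1.2, h3.1]
  · push Not at hr
    linarith [h'.2 _ hr, h1.1]

lemma measurableSet_matchesLevel (x : ℝ) (σ : Fin K ↪ ι) (j : ι) :
    MeasurableSet {y : ℝ | (∀ k : Fin K, σ k = j → y ∈ Set.Ico (l k) (u k)) ∧
      ((∀ k, σ k ≠ j) → y < x)} := by
  refine MeasurableSet.inter ?_ ?_
  · have : {y : ℝ | ∀ k : Fin K, σ k = j → y ∈ Set.Ico (l k) (u k)} =
        ⋂ k : Fin K, ⋂ _ : σ k = j, Set.Ico (l k) (u k) := by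
      ext; simp
    change MeasurableSet {y : ℝ | ∀ k : Fin K, σ k = j → y ∈ Set.Ico (l k) (u k)}
    rw [this]
    exact MeasurableSet.iInter fun k => MeasurableSet.iInter fun _ => measurableSet_Ico
  · have : {y : ℝ | (∀ k, σ k ≠ j) → y < x} = ⋂ _ : ∀ k, σ k ≠ j, Set.Iio x := by
      ext; simp
    change MeasurableSet {y : ℝ | (∀ k, σ k ≠ j) → y < x}
    rw [this]
    exact MeasurableSet.iInter fun _ => measurableSet_Iio

variable [Fintype ι]

lemma not_exists_matchesLevels (d : ι → ℝ) {x : ℝ} (h : K < levelCount d x) :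
    ¬ ∃ σ : Fin K ↪ ι, MatchesLevels l u x d σ := by
  classical
  rintro ⟨σ, -, hσ⟩
  have h1 : (Finset.univ.filter fun i => x ≤ d i) ⊆ Finset.univ.map σ := by
    intro j hj
    simp only [Finset.mem_filter, Finset.mem_univ, true_and] at hj
    by_contra hj'
    simp only [Finset.mem_map, Finset.mem_univ, true_and, not_exists] at hj'
    exact absurd (hσ j hj') (not_lt.2 hj)
  have h2 := Finset.card_le_card h1
  rw [Finset.card_map, Finset.card_univ, Fintype.card_fin] at h2
  exact absurd h2 (not_le.2 h)

/-- Only the `K` largest entries are labelled. That the next one lies in `[l K, u K)` means that the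
remaining entries are all below `u K` but not all below `l K`, so the event is a difference of two
matching events, each of product form for fixed labels. -/
lemma counts_iff_matchesLevels (hlu : ∀ i ≤ K, l i < u i) (hul : ∀ i < K, u (i + 1) ≤ l i)
    (d : ι → ℝ) :
    (∀ i ≤ K, i + 1 ≤ levelCount d (l i) ∧ levelCount d (u i) < i + 1) ↔
      (∃ σ : Fin K ↪ ι, MatchesLevels l u (u K) d σ) ∧
        ¬ ∃ σ : Fin K ↪ ι, MatchesLevels l u (l K) d σ := by
  classical
  constructor
  · intro h
    refine ⟨?_, not_exists_matchesLevels d (h K le_rfl).1⟩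
    have hex : ∀ i : Fin K, ∃ j, d j ∈ Set.Ico (l i) (u i) := by
      intro i
      by_contra! hno
      have h1 : levelCount d (l i) ≤ levelCount d (u i) := by
        refine Finset.card_le_card fun j hj => ?_
        simp only [Finset.mem_filter, Finset.mem_univ, true_and] at hj ⊢
        by_contra hj'
        exact hno j ⟨hj, not_le.1 hj'⟩
      have h2 := h i i.2.le
      omega
    choose σ hσ using hex
    have hinj : Function.Injective σ := by
      intro i j hij
      by_contra hne
      rcases lt_or_gt_of_ne hne with hlt | hlt
      · have h1 := upper_le_lower hlu hul (show (i : ℕ) < j from hlt) j.2.le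
        have h2 := (hσ i).1
        have h3 := (hσ j).2
        rw [hij] at h2
        linarith
      · have h1 := upper_le_lower hlu hul (show (j : ℕ) < i from hlt) i.2.le
        have h2 := (hσ j).1
        have h3 := (hσ i).2
        rw [hij] at h3
        linarith
    refine ⟨⟨σ, hinj⟩, hσ, fun j hj => ?_⟩
    by_contra hj'
    have hsub : insert j (Finset.univ.map ⟨σ, hinj⟩) ⊆
        Finset.univ.filter fun i => u K ≤ d i := by
      intro i hi
      simp only [Finset.mem_insert, Finset.mem_map, Finset.mem_univ, true_and,
        Finset.mem_filter] at hi ⊢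
      rcases hi with rfl | ⟨k, rfl⟩
      · exact not_lt.1 hj'
      · exact (upper_le_lower hlu hul k.2 le_rfl).trans (hσ k).1
    have h1 := Finset.card_le_card hsub
    rw [Finset.card_insert_of_notMem (by simpa using hj), Finset.card_map, Finset.card_univ,
      Fintype.card_fin] at h1
    have h2 := (h K le_rfl).2
    unfold levelCount at h2
    omega
  · rintro ⟨⟨σ, hσ, hrest⟩, hno⟩ i hi
    constructor
    · rcases hi.lt_or_eq with hlt | rfl
      · have hsub : (Finset.univ.filter fun k : Fin K => (k : ℕ) ≤ i).map σ ⊆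
            Finset.univ.filter fun j => l i ≤ d j := by
          intro j hj
          simp only [Finset.mem_map, Finset.mem_filter, Finset.mem_univ, true_and] at hj ⊢
          obtain ⟨k, hk, rfl⟩ := hj
          rcases hk.lt_or_eq with hk' | hk'
          · exact (hlu i hi).le.trans ((upper_le_lower hlu hul hk' hi).trans (hσ k).1)
          · exact hk' ▸ (hσ k).1
        have h1 := Finset.card_le_card hsub
        rw [Finset.card_map] at h1
        have h2 : (Finset.univ.filter fun k : Fin K => (k : ℕ) ≤ i).card = i + 1 := by
          have : (Finset.univ.filter fun k : Fin K => (k : ℕ) ≤ i) = Finset.Iic ⟨i, hlt⟩ := by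
            ext k; simp [Fin.le_def]
          rw [this, Fin.card_Iic]
        rw [h2] at h1
        exact h1
      -- If only `K` entries reached `l K`, the unlabelled ones would all lie below `l K`, and `σ`
      -- would match at that level too.
      · by_contra hcon
        refine hno ⟨σ, hσ, fun j hj => ?_⟩
        by_contra hj'
        apply hcon
        have hsub : insert j (Finset.univ.map σ) ⊆ Finset.univ.filter fun j => l i ≤ d j := by
          intro j' hj'
          simp only [Finset.mem_insert, Finset.mem_map, Finset.mem_univ, true_and,
            Finset.mem_filter] at hj' ⊢
          rcases hj' with rfl | ⟨k, rfl⟩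
          · linarith
          · exact (hlu i le_rfl).le.trans ((upper_le_lower hlu hul k.2 le_rfl).trans (hσ k).1)
        have h1 := Finset.card_le_card hsub
        rwa [Finset.card_insert_of_notMem (by simpa using hj), Finset.card_map, Finset.card_univ,
          Fintype.card_fin] at h1
    · have hsub : (Finset.univ.filter fun j => u i ≤ d j) ⊆
          (Finset.univ.filter fun k : Fin K => (k : ℕ) < i).map σ := by
        intro j hj
        simp only [Finset.mem_map, Finset.mem_filter, Finset.mem_univ, true_and] at hj ⊢
        by_cases hr : ∃ k, σ k = j
        · obtain ⟨k, rfl⟩ := hr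
          refine ⟨k, ?_, rfl⟩
          by_contra hk
          have := upper_le_upper hlu hul (not_lt.1 hk) k.2.le
          linarith [(hσ k).2]
        · push Not at hr
          have := upper_le_upper hlu hul hi le_rfl
          linarith [hrest j hr]
      have h1 := Finset.card_le_card hsub
      rw [Finset.card_map] at h1
      have h2 : (Finset.univ.filter fun k : Fin K => (k : ℕ) < i).card ≤ i := by
        have h3 : ((Finset.univ.filter fun k : Fin K => (k : ℕ) < i).map Fin.valEmbedding) ⊆
            Finset.range i := by
          intro k hk
          simp only [Finset.mem_map, Finset.mem_filter, Finset.mem_univ, true_and] at hk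
          obtain ⟨k', h, rfl⟩ := hk
          exact Finset.mem_range.2 h
        simpa using Finset.card_le_card h3
      exact Nat.lt_succ_of_le (h1.trans h2)

lemma setOf_matchesLevels {Ω : Type*} (D : ι → Ω → ℝ) (x : ℝ) (σ : Fin K ↪ ι) :
    {ω | MatchesLevels l u x (fun i => D i ω) σ} =
      ⋂ j ∈ (Finset.univ : Finset ι), D j ⁻¹'
        {y | (∀ k : Fin K, σ k = j → y ∈ Set.Ico (l k) (u k)) ∧ ((∀ k, σ k ≠ j) → y < x)} := by
  ext ω
  simp only [MatchesLevels, Set.mem_ofPred_eq, Finset.mem_univ, Set.iInter_true, Set.mem_iInter,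
    Set.mem_preimage]
  constructor
  · rintro ⟨h1, h2⟩ j
    exact ⟨fun k hk => hk ▸ h1 k, h2 j⟩
  · intro h
    exact ⟨fun k => (h (σ k)).1 k rfl, fun j => (h j).2⟩

variable {Ω : Type*} [MeasurableSpace Ω] {P : Measure Ω}

lemma measure_matchesLevels {D : ι → Ω → ℝ} (hind : iIndepFun D P) {μ : Measure ℝ}
    (hD : ∀ i, ∀ s, MeasurableSet s → P (D i ⁻¹' s) = μ s) (x : ℝ) (σ : Fin K ↪ ι) :
    P {ω | MatchesLevels l u x (fun i => D i ω) σ} =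
      (∏ k : Fin K, μ (Set.Ico (l k) (u k))) * μ (Set.Iio x) ^ (Fintype.card ι - K) := by
  classical
  rw [setOf_matchesLevels, iIndepFun_iff_measure_inter_preimage_eq_mul.1 hind _
    fun j _ => measurableSet_matchesLevel x σ j]
  rw [← Finset.prod_mul_prod_compl (Finset.univ.map σ), Finset.prod_map]
  congr 1
  · refine Finset.prod_congr rfl fun k _ => ?_
    rw [hD _ _ (measurableSet_matchesLevel x σ _)]
    congr 1
    ext y
    constructor
    · exact fun h => h.1 k rfl
    · exact fun h => ⟨fun k' hk' => σ.injective hk' ▸ h, fun h' => absurd rfl (h' k)⟩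
  · rw [Finset.prod_congr rfl (g := fun _ => μ (Set.Iio x)), Finset.prod_const,
      Finset.card_compl, Finset.card_map, Finset.card_univ, Fintype.card_fin]
    intro j hj
    simp only [Finset.mem_compl, Finset.mem_map, Finset.mem_univ, true_and, not_exists] at hj
    rw [hD _ _ (measurableSet_matchesLevel x σ _)]
    congr 1
    ext y
    exact ⟨fun h => h.2 hj, fun h => ⟨fun k hk => absurd hk (hj k), fun _ => h⟩⟩

lemma measurableSet_matchesLevels {D : ι → Ω → ℝ} (hm : ∀ i, Measurable (D i)) (x : ℝ)
    (σ : Fin K ↪ ι) : MeasurableSet {ω | MatchesLevels l u x (fun i => D i ω) σ} := by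
  rw [setOf_matchesLevels]
  exact Finset.measurableSet_biInter _ fun j _ => hm j (measurableSet_matchesLevel x σ j)

/-- A disjoint union over the `descFactorial` many labellings, all of the same probability by
independence and equality of laws. -/
lemma measure_exists_matchesLevels {D : ι → Ω → ℝ} (hm : ∀ i, Measurable (D i))
    (hind : iIndepFun D P) {μ : Measure ℝ}
    (hD : ∀ i, ∀ s, MeasurableSet s → P (D i ⁻¹' s) = μ s)
    (hlu : ∀ i ≤ K, l i < u i) (hul : ∀ i < K, u (i + 1) ≤ l i) {x : ℝ} (hx : x ≤ u K) :
    P {ω | ∃ σ : Fin K ↪ ι, MatchesLevels l u x (fun i => D i ω) σ} =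
      (Fintype.card ι).descFactorial K *
        ((∏ k : Fin K, μ (Set.Ico (l k) (u k))) * μ (Set.Iio x) ^ (Fintype.card ι - K)) := by
  classical
  rw [Set.ofPred_exists, measure_iUnion]
  · simp_rw [measure_matchesLevels hind hD]
    rw [tsum_fintype, Finset.sum_const, Finset.card_univ, Fintype.card_embedding_eq,
      Fintype.card_fin, nsmul_eq_mul]
  · intro σ σ' hne
    refine Set.disjoint_left.2 fun ω h h' => hne ?_
    exact MatchesLevels.eq (d := fun i => D i ω) hlu hul hx h h'
  · exact measurableSet_matchesLevels hm x

lemma measurableSet_exists_matchesLevels {D : ι → Ω → ℝ} (hm : ∀ i, Measurable (D i)) (x : ℝ) :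
    MeasurableSet {ω | ∃ σ : Fin K ↪ ι, MatchesLevels l u x (fun i => D i ω) σ} := by
  classical
  rw [Set.ofPred_exists]
  exact MeasurableSet.iUnion fun σ => measurableSet_matchesLevels hm x σ

/-- The joint law of the order statistics of independent identically distributed variables, on
ordered boxes. -/
lemma measureReal_counts [IsProbabilityMeasure P] {D : ι → Ω → ℝ} (hm : ∀ i, Measurable (D i))
    (hind : iIndepFun D P) {μ : Measure ℝ} [IsProbabilityMeasure μ]
    (hD : ∀ i, ∀ s, MeasurableSet s → P (D i ⁻¹' s) = μ s)
    (hlu : ∀ i ≤ K, l i < u i) (hul : ∀ i < K, u (i + 1) ≤ l i) :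
    P.real {ω | ∀ i ≤ K, i + 1 ≤ levelCount (fun j => D j ω) (l i) ∧
        levelCount (fun j => D j ω) (u i) < i + 1} =
      (Fintype.card ι).descFactorial K *
        ((∏ k : Fin K, μ.real (Set.Ico (l k) (u k))) *
          (μ.real (Set.Iio (u K)) ^ (Fintype.card ι - K) -
            μ.real (Set.Iio (l K)) ^ (Fintype.card ι - K))) := by
  have hset : {ω | ∀ i ≤ K, i + 1 ≤ levelCount (fun j => D j ω) (l i) ∧
        levelCount (fun j => D j ω) (u i) < i + 1} =
      {ω | ∃ σ : Fin K ↪ ι, MatchesLevels l u (u K) (fun i => D i ω) σ} \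
        {ω | ∃ σ : Fin K ↪ ι, MatchesLevels l u (l K) (fun i => D i ω) σ} := by
    ext ω
    exact counts_iff_matchesLevels hlu hul _
  rw [hset, measureReal_sdiff _ (measurableSet_exists_matchesLevels hm _)]
  · simp only [measureReal_def, measure_exists_matchesLevels hm hind hD hlu hul le_rfl,
      measure_exists_matchesLevels hm hind hD hlu hul (hlu K le_rfl).le, ENNReal.toReal_mul,
      ENNReal.toReal_natCast, ENNReal.toReal_prod, ENNReal.toReal_pow]
    ring
  · rintro ω ⟨σ, h1, h2⟩
    exact ⟨σ, h1, fun j hj => (h2 j hj).trans (hlu K le_rfl)⟩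

end OrderStatistics

/-! ### Poisson limits and limits of events -/

lemma tendsto_descFactorial_mul_prod (K : ℕ) {q : ℕ → ℕ → ℝ} {r : ℕ → ℝ}
    (h : ∀ k < K, Tendsto (fun m : ℕ => m * q m k) atTop (𝓝 (r k))) :
    Tendsto (fun m : ℕ => (m.descFactorial K : ℝ) * ∏ k : Fin K, q m k) atTop
      (𝓝 (∏ k : Fin K, r k)) := by
  have h1 : Tendsto (fun m : ℕ => ∏ k : Fin K, ((m : ℝ) * q m k)) atTop (𝓝 (∏ k : Fin K, r k)) :=
    tendsto_finsetProd _ fun k _ => h k k.2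
  have h2 : Asymptotics.IsEquivalent atTop (fun m : ℕ => (m.descFactorial K : ℝ) * ∏ k : Fin K, q m k)
      (fun m : ℕ => ∏ k : Fin K, ((m : ℝ) * q m k)) := by
    have : (fun m : ℕ => ∏ k : Fin K, ((m : ℝ) * q m k)) =
        fun m : ℕ => (m : ℝ) ^ K * ∏ k : Fin K, q m k := by
      ext m
      simp [Finset.prod_mul_distrib]
    rw [this]
    exact (isEquivalent_descFactorial K).mul Asymptotics.IsEquivalent.refl
  exact h2.symm.tendsto_nhds h1

lemma tendsto_one_sub_pow_sub (K : ℕ) {p : ℕ → ℝ} {r : ℝ}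
    (h : Tendsto (fun m : ℕ => m * p m) atTop (𝓝 r)) :
    Tendsto (fun m => (1 - p m) ^ (m - K)) atTop (𝓝 (Real.exp (-r))) := by
  have hp0 := tendsto_zero_of_tendsto_mul_atTop h
  have h1 : Tendsto (fun m => (1 - p m) ^ m * ((1 - p m) ^ K)⁻¹) atTop
      (𝓝 (Real.exp (-r) * ((1 - 0) ^ K)⁻¹)) := by
    refine Tendsto.mul ?_ (Tendsto.inv₀ ((tendsto_const_nhds.sub hp0).pow K) (by simp))
    have : Tendsto (fun m : ℕ => m * (-p m)) atTop (𝓝 (-r)) := by simpa using h.neg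
    simpa [sub_eq_add_neg] using Real.tendsto_one_add_pow_exp_of_tendsto this
  rw [sub_zero, one_pow, inv_one, mul_one] at h1
  refine h1.congr' ?_
  filter_upwards [eventually_ge_atTop K, hp0.eventually_lt_const zero_lt_one] with m hm hp
  rw [pow_sub₀ _ (by linarith) hm]

section Limits

variable {Ω : Type*} [MeasurableSpace Ω] {P : Measure Ω}

/-- Fatou's lemma for sets: up to a null set, `A` lies in the lower limit of the `B m`. -/
lemma measure_le_of_eventually_mem {A : Set Ω} {B : ℕ → Set Ω} {p : ℝ≥0∞}
    (hA : ∀ᵐ ω ∂P, ω ∈ A → ∀ᶠ m in atTop, ω ∈ B m)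
    (hp : Tendsto (fun m => P (B m)) atTop (𝓝 p)) : P A ≤ p := by
  have h1 : P A ≤ P (⋃ n, ⋂ m ∈ Set.Ici n, B m) := by
    refine measure_mono_ae ?_
    filter_upwards [hA] with ω hω hωA
    obtain ⟨n, hn⟩ := eventually_atTop.1 (hω hωA)
    exact Set.mem_iUnion.2 ⟨n, Set.mem_iInter₂.2 fun m hm => hn m hm⟩
  refine h1.trans ?_
  rw [Monotone.measure_iUnion]
  · refine iSup_le fun n => ge_of_tendsto hp ?_
    filter_upwards [eventually_ge_atTop n] with m hm
    exact measure_mono (Set.biInter_subset_of_mem hm)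
  · intro n n' h
    exact Set.biInter_subset_biInter_left (Set.Ici_subset_Ici.2 h)

lemma measurableSet_eventually_mem {B : ℕ → Set Ω} (hB : ∀ m, MeasurableSet (B m)) :
    MeasurableSet {ω | ∀ᶠ m in atTop, ω ∈ B m} := by
  have : {ω | ∀ᶠ m in atTop, ω ∈ B m} = ⋃ n, ⋂ m, ⋂ _ : n ≤ m, B m := by
    ext ω; simp [eventually_atTop]
  rw [this]
  exact MeasurableSet.iUnion fun n => MeasurableSet.iInter fun m => MeasurableSet.iInter fun _ =>
    hB m

lemma le_measureReal_of_eventually_notMem [IsProbabilityMeasure P] {C : Set Ω} {B : ℕ → Set Ω}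
    {p : ℝ} (hC : NullMeasurableSet C P) (hB : ∀ m, MeasurableSet (B m))
    (hA : ∀ᵐ ω ∂P, ω ∉ C → ∀ᶠ m in atTop, ω ∉ B m)
    (hp : Tendsto (fun m => P.real (B m)) atTop (𝓝 p)) : p ≤ P.real C := by
  have h1 : Tendsto (fun m => P (B m)ᶜ) atTop (𝓝 (ENNReal.ofReal (1 - p))) := by
    refine (ENNReal.tendsto_ofReal (tendsto_const_nhds.sub hp)).congr fun m => ?_
    rw [← probReal_compl_eq_one_sub (hB m), ofReal_measureReal]
  have h2 := measure_le_of_eventually_mem (A := Cᶜ) (B := fun m => (B m)ᶜ) hA h1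
  have hp1 : p ≤ 1 := le_of_tendsto hp (Eventually.of_forall fun m => measureReal_le_one)
  have h3 : P.real Cᶜ ≤ 1 - p := ENNReal.toReal_le_of_le_ofReal (by linarith) h2
  rw [probReal_compl_eq_one_sub₀ hC] at h3
  linarith

end Limits

/-! ### Joint law of the largest flights -/

section OrderSequence

variable {Ω : Type*} [MeasurableSpace Ω] {P : Measure Ω} {L : ℝ≥0 → Ω → ℝ}

lemma gridCount_eq_levelCount (f : ℝ≥0 → ℝ) (t : ℝ≥0) (m : ℕ) (x : ℝ) :
    gridCount f t m x = levelCount (fun i : Fin m => gridInc f t m i) x := by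
  simp only [gridCount, levelCount, Finset.card_filter]
  exact Finset.sum_range _

lemma measurable_gridInc (hL : ∀ s, Measurable (L s)) (t : ℝ≥0) (m i : ℕ) :
    Measurable fun ω => gridInc (fun s => L s ω) t m i :=
  (hL _).sub (hL _)

lemma measurable_gridCount (hL : ∀ s, Measurable (L s)) (t : ℝ≥0) (m : ℕ) (x : ℝ) :
    Measurable fun ω => gridCount (fun s => L s ω) t m x := by
  simp only [gridCount, Finset.card_filter]
  refine Finset.measurable_fun_sum _ fun i _ => ?_
  exact Measurable.ite (measurableSet_le measurable_const (measurable_gridInc hL t m i))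
    measurable_const measurable_const

lemma IsOneSidedLevyProcess.iIndepFun_gridInc (hL : IsOneSidedLevyProcess L P) (t : ℝ≥0) (m : ℕ) :
    iIndepFun (fun (i : Fin m) ω => gridInc (fun s => L s ω) t m i) P :=
  (hL.indep_increments.nat (gridPt_mono t m)).precomp Fin.val_injective

lemma IsOneSidedLevyProcess.measure_gridInc_preimage (hL : IsOneSidedLevyProcess L P) (t : ℝ≥0)
    (m i : ℕ) {s : Set ℝ} (hs : MeasurableSet s) :
    P ((fun ω => gridInc (fun s => L s ω) t m i) ⁻¹' s) = P.map (L (t / m)) s := by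
  have h1 := (hL.stationary_increments (gridPt t m i) (t / m)).measure_mem_eq hs
  rw [Measure.map_apply (hL.measurable _) hs]
  have h2 : (fun ω => gridInc (fun s => L s ω) t m i) =
      L (gridPt t m i + t / m) - L (gridPt t m i) := by
    ext ω
    simp [gridInc, gridPt_succ]
  rw [h2, h1]
  refine measure_congr ?_
  filter_upwards [hL.start_zero] with ω hω
  refine propext ?_
  change (L (t / m) - L 0) ω ∈ s ↔ L (t / m) ω ∈ s
  rw [Pi.sub_apply, hω, sub_zero]

/-- For `x ≥ 0` and càdlàg paths, exceeding `x` means that for some rational `q > x` at least `n`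
increments reach `q` on all fine grids; this is a countable combination of measurable events. -/
lemma aemeasurable_orderSeq (hL : IsOneSidedLevyProcess L P) (t : ℝ≥0) {n : ℕ} (hn : 1 ≤ n) :
    AEMeasurable (orderSeq L n t) P := by
  have hnull : NullMeasurable (orderSeq L n t) P := by
    refine measurable_of_Ioi (δ := NullMeasurableSpace Ω P) fun x => ?_
    change NullMeasurableSet (orderSeq L n t ⁻¹' Set.Ioi x) P
    rcases lt_or_ge x 0 with hx | hx
    · have : orderSeq L n t ⁻¹' Set.Ioi x = Set.univ :=
        Set.eq_univ_of_forall fun ω => hx.trans_le (nthLargestFlight_nonneg _ t n)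
      rw [this]
      exact MeasurableSet.univ.nullMeasurableSet
    · have hmeas : MeasurableSet (⋃ q : ℚ, ⋃ _ : x < q,
          {ω | ∀ᶠ m in atTop, n ≤ gridCount (fun s => L s ω) t m q}) :=
        MeasurableSet.iUnion fun q => MeasurableSet.iUnion fun _ =>
          measurableSet_eventually_mem fun m =>
            measurableSet_le measurable_const (measurable_gridCount hL.measurable t m _)
      refine hmeas.nullMeasurableSet.congr ?_
      filter_upwards [hL.cadlag] with ω hω
      refine propext ?_
      change ω ∈ (⋃ q : ℚ, ⋃ _ : x < q,
          {ω | ∀ᶠ m in atTop, n ≤ gridCount (fun s => L s ω) t m q}) ↔ x < orderSeq L n t ω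
      simp only [Set.mem_iUnion, Set.mem_ofPred_eq, exists_prop]
      constructor
      · rintro ⟨q, hxq, hq⟩
        by_contra hcon
        have h1 := hω.eventually_gridCount_lt_of_lt (hx.trans_lt hxq) hn
          ((not_lt.1 hcon).trans_lt hxq)
        obtain ⟨m, h2, h3⟩ := (hq.and h1).exists
        omega
      · intro h
        obtain ⟨q, hxq, hq⟩ := exists_rat_btwn h
        exact ⟨q, hxq, hω.eventually_le_gridCount_of_lt (hx.trans_lt hxq) hq⟩
  exact hnull.aemeasurable

variable [IsProbabilityMeasure P]

/-- The probability that the largest increments over a fine grid lie in given ordered intervals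
converges to its Poisson limit. -/
lemma tendsto_measureReal_gridCounts (hL : IsOneSidedLevyProcess L P) {ν : Measure ℝ}
    (hν : IsOneSidedLevyMeasure ν) (hLν : HasLevyMeasure L P ν) {g : ℝ → ℝ}
    (hg : ∀ x, 0 < x → flightTail ν x = ENNReal.ofReal (g x)) (hg0 : ∀ x, 0 < x → 0 ≤ g x)
    (hgc : ∀ x, 0 < x → ContinuousAt g x) (t : ℝ≥0) {K : ℕ} {l u : ℕ → ℝ}
    (hlu : ∀ i ≤ K, l i < u i) (hul : ∀ i < K, u (i + 1) ≤ l i) (hl : ∀ i ≤ K, 0 < l i) :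
    Tendsto (fun m => P.real {ω | ∀ i ≤ K, i + 1 ≤ gridCount (fun s => L s ω) t m (l i) ∧
        gridCount (fun s => L s ω) t m (u i) < i + 1}) atTop
      (𝓝 ((∏ k : Fin K, (t * g (l k) - t * g (u k))) *
        (Real.exp (-(t * g (u K))) - Real.exp (-(t * g (l K)))))) := by
  have hmap : ∀ s, IsProbabilityMeasure (P.map (L s)) := fun s =>
    Measure.isProbabilityMeasure_map (hL.measurable s).aemeasurable
  have htail : ∀ x, 0 < x → Tendsto (fun m : ℕ => m * (P.map (L (t / m))).real (Set.Ici x)) atTop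
      (𝓝 (t * g x)) := by
    intro x hx
    refine (tendsto_mul_increment_tail hL hν hLν hg hg0 t hx (hgc x hx)).congr fun m => ?_
    rw [map_measureReal_apply (hL.measurable _) measurableSet_Ici]
    rfl
  have hu : ∀ i ≤ K, 0 < u i := fun i hi => (hl i hi).trans (hlu i hi)
  have hIio : ∀ (m : ℕ) (x : ℝ), (P.map (L (t / m))).real (Set.Iio x) =
      1 - (P.map (L (t / m))).real (Set.Ici x) := by
    intro m x
    rw [← Set.compl_Ici, probReal_compl_eq_one_sub measurableSet_Ici]
  have hIco : ∀ k < K, Tendsto (fun m : ℕ => m * (P.map (L (t / m))).real (Set.Ico (l k) (u k)))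
      atTop (𝓝 (t * g (l k) - t * g (u k))) := by
    intro k hk
    refine ((htail _ (hl k hk.le)).sub (htail _ (hu k hk.le))).congr fun m => ?_
    rw [← Set.Ici_sdiff_Ici, measureReal_sdiff (Set.Ici_subset_Ici.2 (hlu k hk.le).le)
      measurableSet_Ici]
    ring
  have h1 := tendsto_descFactorial_mul_prod K hIco
  have h2 := h1.mul ((tendsto_one_sub_pow_sub K (htail _ (hu K le_rfl))).sub
    (tendsto_one_sub_pow_sub K (htail _ (hl K le_rfl))))
  refine h2.congr fun m => ?_
  have h3 := measureReal_counts (P := P) (D := fun (i : Fin m) ω => gridInc (fun s => L s ω) t m i)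
    (fun i => measurable_gridInc hL.measurable t m i) (hL.iIndepFun_gridInc t m)
    (μ := P.map (L (t / m))) (fun i s hs => hL.measure_gridInc_preimage t m i hs) hlu hul
  simp only [← gridCount_eq_levelCount, Fintype.card_fin] at h3
  rw [h3, hIio, hIio]
  ring

lemma measurableSet_gridCounts (hL : ∀ s, Measurable (L s)) (t : ℝ≥0) (K m : ℕ) (l u : ℕ → ℝ) :
    MeasurableSet {ω | ∀ i ≤ K, i + 1 ≤ gridCount (fun s => L s ω) t m (l i) ∧
        gridCount (fun s => L s ω) t m (u i) < i + 1} := by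
  have : {ω | ∀ i ≤ K, i + 1 ≤ gridCount (fun s => L s ω) t m (l i) ∧
        gridCount (fun s => L s ω) t m (u i) < i + 1} = ⋂ i, ⋂ _ : i ≤ K,
      ({ω | i + 1 ≤ gridCount (fun s => L s ω) t m (l i)} ∩
        {ω | gridCount (fun s => L s ω) t m (u i) < i + 1}) := by
    ext; simp
  rw [this]
  refine MeasurableSet.iInter fun i => MeasurableSet.iInter fun _ => ?_
  exact (measurableSet_le measurable_const (measurable_gridCount hL t m _)).inter
    (measurableSet_lt (measurable_gridCount hL t m _) measurable_const)

/-- The joint law of the largest flights on ordered open boxes. -/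
lemma measureReal_orderSeq_box (hL : IsOneSidedLevyProcess L P) {ν : Measure ℝ}
    (hν : IsOneSidedLevyMeasure ν) (hLν : HasLevyMeasure L P ν) {g : ℝ → ℝ}
    (hg : ∀ x, 0 < x → flightTail ν x = ENNReal.ofReal (g x)) (hg0 : ∀ x, 0 < x → 0 ≤ g x)
    (hgc : ∀ x, 0 < x → ContinuousAt g x) (t : ℝ≥0) {K : ℕ} {l u : ℕ → ℝ}
    (hlu : ∀ i ≤ K, l i < u i) (hul : ∀ i < K, u (i + 1) ≤ l i) (hl : ∀ i ≤ K, 0 < l i) :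
    P.real {ω | ∀ i ≤ K, l i < orderSeq L (i + 1) t ω ∧ orderSeq L (i + 1) t ω < u i} =
      (∏ k : Fin K, (t * g (l k) - t * g (u k))) *
        (Real.exp (-(t * g (u K))) - Real.exp (-(t * g (l K)))) := by
  have hu : ∀ i ≤ K, 0 < u i := fun i hi => (hl i hi).trans (hlu i hi)
  apply le_antisymm
  · have h1 := tendsto_measureReal_gridCounts hL hν hLν hg hg0 hgc t hlu hul hl
    have h0 := ge_of_tendsto h1 (Eventually.of_forall fun m => measureReal_nonneg)
    refine ENNReal.toReal_le_of_le_ofReal h0 (measure_le_of_eventually_mem ?_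
      ((ENNReal.tendsto_ofReal h1).congr fun m => ofReal_measureReal))
    filter_upwards [hL.cadlag] with ω hω hmem
    have h2 := (Set.finite_Iic K).eventually_all (l := atTop) (p := fun i m =>
      i + 1 ≤ gridCount (fun s => L s ω) t m (l i) ∧
        gridCount (fun s => L s ω) t m (u i) < i + 1)
    refine h2.2 fun i hi => ?_
    exact (hω.eventually_le_gridCount_of_lt (hl i hi) (hmem i hi).1).and
      (hω.eventually_gridCount_lt_of_lt (hu i hi) (by omega) (hmem i hi).2)
  -- The grid criterion needs strict inequalities and says nothing at the endpoints. For the lower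
  -- bound the boxes are shrunk by `ε`, so that paths outside the open box fail the shrunken grid
  -- event; continuity of `g` then removes `ε`.
  · have hlim : Tendsto (fun ε : ℝ => (∏ k : Fin K, (t * g (l k + ε) - t * g (u k - ε))) *
        (Real.exp (-(t * g (u K - ε))) - Real.exp (-(t * g (l K + ε))))) (𝓝[>] 0)
        (𝓝 ((∏ k : Fin K, (t * g (l k) - t * g (u k))) *
        (Real.exp (-(t * g (u K))) - Real.exp (-(t * g (l K)))))) := by
      have hl' : ∀ i ≤ K, Tendsto (fun ε : ℝ => t * g (l i + ε)) (𝓝[>] 0) (𝓝 (t * g (l i))) := by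
        intro i hi
        refine ((hgc _ (hl i hi)).tendsto.comp ?_).const_mul _
        exact (Continuous.tendsto' (by fun_prop) _ _ (by simp)).mono_left nhdsWithin_le_nhds
      have hu' : ∀ i ≤ K, Tendsto (fun ε : ℝ => t * g (u i - ε)) (𝓝[>] 0) (𝓝 (t * g (u i))) := by
        intro i hi
        refine ((hgc _ (hu i hi)).tendsto.comp ?_).const_mul _
        exact (Continuous.tendsto' (by fun_prop) _ _ (by simp)).mono_left nhdsWithin_le_nhds
      refine Tendsto.mul (tendsto_finsetProd _ fun k _ => (hl' k k.2.le).sub (hu' k k.2.le)) ?_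
      exact ((hu' K le_rfl).neg.rexp).sub ((hl' K le_rfl).neg.rexp)
    refine le_of_tendsto hlim ?_
    have hε : ∀ᶠ ε : ℝ in 𝓝[>] 0, ∀ i ∈ Set.Iic K, l i + ε < u i - ε := by
      refine ((Set.finite_Iic K).eventually_all).2 fun i hi => nhdsWithin_le_nhds ?_
      have : Tendsto (fun ε : ℝ => (u i - ε) - (l i + ε)) (𝓝 0) (𝓝 (u i - l i)) :=
        Continuous.tendsto' (by fun_prop) _ _ (by simp)
      filter_upwards [this.eventually_const_lt (sub_pos.2 (hlu i hi))] with ε h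
      linarith
    filter_upwards [hε, self_mem_nhdsWithin] with ε h hpos
    have hpos : 0 < ε := hpos
    have h1 := tendsto_measureReal_gridCounts hL hν hLν hg hg0 hgc t
      (l := fun i => l i + ε) (u := fun i => u i - ε) (K := K) (fun i hi => h i hi)
      (fun i hi => by linarith [hul i hi]) (fun i hi => by linarith [hl i hi])
    refine le_measureReal_of_eventually_notMem ?_
      (fun m => measurableSet_gridCounts hL.measurable t K m _ _) ?_ h1
    · have : {ω | ∀ i ≤ K, l i < orderSeq L (i + 1) t ω ∧ orderSeq L (i + 1) t ω < u i} =
          ⋂ i, ⋂ _ : i ≤ K, orderSeq L (i + 1) t ⁻¹' Set.Ioo (l i) (u i) := by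
        ext; simp
      rw [this]
      exact NullMeasurableSet.iInter fun i => NullMeasurableSet.iInter fun _ =>
        (aemeasurable_orderSeq hL t (by omega)).nullMeasurable measurableSet_Ioo
    · filter_upwards [hL.cadlag] with ω hω hmem
      simp only [not_forall] at hmem
      obtain ⟨i, hi, hnot⟩ := hmem
      rcases not_and_or.1 hnot with h2 | h2
      · filter_upwards [hω.eventually_gridCount_lt_of_lt (x := l i + ε) (n := i + 1) (t := t)
          (by linarith [hl i hi]) (by omega) (lt_of_le_of_lt (not_lt.1 h2) (by linarith))]
          with m hm hcon
        have := (hcon i hi).1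
        omega
      · filter_upwards [hω.eventually_le_gridCount_of_lt (x := u i - ε) (n := i + 1) (t := t)
          (by linarith [hl i hi, h i hi]) (lt_of_lt_of_le (by linarith) (not_lt.1 h2))]
          with m hm hcon
        have := (hcon i hi).2
        omega

end OrderSequence

/-! ### Passage to Poisson arrival times -/

/-- The measure on `ℝ` with density `exp (-y)`. -/
noncomputable def expDensityMeasure : Measure ℝ :=
  volume.withDensity fun y => ENNReal.ofReal (Real.exp (-y))

instance : IsLocallyFiniteMeasure expDensityMeasure :=
  IsLocallyFiniteMeasure.withDensity_ofReal (by fun_prop)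

lemma expDensityMeasure_Ioi (b : ℝ) :
    expDensityMeasure (Set.Ioi b) = ENNReal.ofReal (Real.exp (-b)) := by
  rw [expDensityMeasure, withDensity_apply _ measurableSet_Ioi, ← integral_exp_neg_Ioi b,
    ofReal_integral_eq_lintegral_ofReal]
  · exact integrableOn_exp_neg_Ioi b
  · exact Eventually.of_forall fun y => (Real.exp_pos _).le

lemma expDensityMeasure_Ioo {c d : ℝ} (h : c < d) :
    expDensityMeasure (Set.Ioo c d) = ENNReal.ofReal (Real.exp (-c) - Real.exp (-d)) := by
  have h1 : expDensityMeasure (Set.Ici d) = ENNReal.ofReal (Real.exp (-d)) := by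
    have : NullSingletonClass expDensityMeasure :=
      ⟨fun x => withDensity_absolutelyContinuous volume _ (measure_singleton x)⟩
    rw [← expDensityMeasure_Ioi, measure_congr Ioi_ae_eq_Ici]
  have h2 : Set.Ioo c d = Set.Ioi c \ Set.Ici d := by
    ext y; simp
  rw [h2, measure_sdiff (Set.Ici_subset_Ioi.2 h) measurableSet_Ici.nullMeasurableSet
    (by rw [h1]; exact ENNReal.ofReal_ne_top), h1, expDensityMeasure_Ioi,
    ENNReal.ofReal_sub _ (Real.exp_pos _).le]

/-- On ordered vectors, the product of these measures is the joint law of the first `K + 1` arrival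
times of a Poisson process of rate `1`. -/
noncomputable def arrivalMeasure (K : ℕ) (i : Fin (K + 1)) : Measure ℝ :=
  if i = Fin.last K then expDensityMeasure else volume

lemma arrivalMeasure_castSucc {K : ℕ} (i : Fin K) : arrivalMeasure K i.castSucc = volume :=
  if_neg (Fin.castSucc_lt_last i).ne

lemma arrivalMeasure_last (K : ℕ) : arrivalMeasure K (Fin.last K) = expDensityMeasure :=
  if_pos rfl

instance (K : ℕ) (i : Fin (K + 1)) : IsLocallyFiniteMeasure (arrivalMeasure K i) := by
  unfold arrivalMeasure
  split_ifs <;> infer_instance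

instance (K : ℕ) (i : Fin (K + 1)) : SigmaFinite (arrivalMeasure K i) := by
  unfold arrivalMeasure
  split_ifs <;> infer_instance

/-- The number `t X ^ (-α)` for `X` the `(i + 1)`-th largest flight in `[0, t]`: the expected
number of larger flights. -/
noncomputable def arrivalVec {Ω : Type*} (L : ℝ≥0 → Ω → ℝ) (α : ℝ) (t : ℝ≥0) (K : ℕ) (ω : Ω)
    (i : Fin (K + 1)) : ℝ :=
  t * orderSeq L (i + 1) t ω ^ (-α)

section Levels

variable {α : ℝ} {t : ℝ≥0}

/-- The level `x` with `t x ^ (-α) = c`. -/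
noncomputable def levelOf (α : ℝ) (t : ℝ≥0) (c : ℝ) : ℝ := (c / t) ^ (-α⁻¹)

lemma levelOf_pos (ht : 0 < t) {c : ℝ} (hc : 0 < c) : 0 < levelOf α t c := by
  have : (0 : ℝ) < t := ht
  exact Real.rpow_pos_of_pos (by positivity) _

lemma mul_rpow_levelOf (hα : 0 < α) (ht : 0 < t) {c : ℝ} (hc : 0 < c) :
    t * levelOf α t c ^ (-α) = c := by
  have ht' : (0 : ℝ) < t := ht
  rw [levelOf, ← Real.rpow_mul (by positivity), neg_mul_neg, inv_mul_cancel₀ hα.ne',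
    Real.rpow_one]
  field_simp

lemma lt_mul_rpow_iff (hα : 0 < α) (ht : 0 < t) {c X : ℝ} (hc : 0 < c) (hX : 0 < X) :
    c < t * X ^ (-α) ↔ X < levelOf α t c := by
  have ht' : (0 : ℝ) < t := ht
  conv_lhs => rw [← mul_rpow_levelOf hα ht hc]
  rw [mul_lt_mul_iff_right₀ ht',
    Real.rpow_lt_rpow_iff_of_neg (levelOf_pos ht hc) hX (by linarith)]

lemma mul_rpow_lt_iff (hα : 0 < α) (ht : 0 < t) {c X : ℝ} (hc : 0 < c) (hX : 0 < X) :
    t * X ^ (-α) < c ↔ levelOf α t c < X := by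
  have ht' : (0 : ℝ) < t := ht
  conv_lhs => rw [← mul_rpow_levelOf hα ht hc]
  rw [mul_lt_mul_iff_right₀ ht',
    Real.rpow_lt_rpow_iff_of_neg hX (levelOf_pos ht hc) (by linarith)]

/-- Since `0 ^ (-α)` is `0` by convention, an absent flight is sent to `0` and not to infinity;
positivity excludes it. -/
lemma pos_of_mul_rpow_pos (hα : 0 < α) {X : ℝ} (hX0 : 0 ≤ X) (hX : 0 < t * X ^ (-α)) :
    0 < X := by
  rcases hX0.lt_or_eq with h | rfl
  · exact h
  · rw [Real.zero_rpow (by linarith), mul_zero] at hX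
    exact absurd hX (lt_irrefl _)

lemma levelOf_lt_levelOf (hα : 0 < α) (ht : 0 < t) {c d : ℝ} (hc : 0 < c) (hcd : c < d) :
    levelOf α t d < levelOf α t c := by
  rw [← mul_rpow_lt_iff hα ht (hc.trans hcd) (levelOf_pos ht hc), mul_rpow_levelOf hα ht hc]
  exact hcd

end Levels

section Law

variable {Ω : Type*} [MeasurableSpace Ω] {P : Measure Ω}
  {α : ℝ} {L : ℝ≥0 → Ω → ℝ}

lemma IsSelfsimilarOLP.aemeasurable_arrivalVec (hL : IsSelfsimilarOLP α L P) (t : ℝ≥0) (K : ℕ) :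
    AEMeasurable (arrivalVec L α t K) P :=
  aemeasurable_pi_lambda _ fun i =>
    ((aemeasurable_orderSeq hL.1 t (by omega)).pow_const (-α)).const_mul (t : ℝ)

variable [IsProbabilityMeasure P]

lemma IsSelfsimilarOLP.measure_arrivalVec_box (hL : IsSelfsimilarOLP α L P) (hα : 0 < α)
    {t : ℝ≥0} (ht : 0 < t) {K : ℕ} {c d : Fin (K + 1) → ℝ} (hc : ∀ i, 0 < c i)
    (hcd : ∀ i, c i < d i) (hdc : ∀ i : Fin K, d i.castSucc ≤ c i.succ) :
    P {ω | ∀ i, arrivalVec L α t K ω i ∈ Set.Ioo (c i) (d i)} =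
      ∏ i, arrivalMeasure K i (Set.Ioo (c i) (d i)) := by
  obtain ⟨hL1, ν, hν, hLν, htail⟩ := hL
  have hd : ∀ i, 0 < d i := fun i => (hc i).trans (hcd i)
  have hfin : ∀ i : ℕ, i ≤ K → ∃ j : Fin (K + 1), (j : ℕ) = i := fun i hi => ⟨⟨i, by omega⟩, rfl⟩
  -- The map `x ↦ t x ^ (-α)` is decreasing, so upper ends become lower levels. `Fin.ofNat` wraps
  -- around, but only indices up to `K` are used.
  let l : ℕ → ℝ := fun i => levelOf α t (d (Fin.ofNat (K + 1) i))
  let u : ℕ → ℝ := fun i => levelOf α t (c (Fin.ofNat (K + 1) i))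
  have hof : ∀ j : Fin (K + 1), Fin.ofNat (K + 1) (j : ℕ) = j := fun j => by simp
  have hbox := measureReal_orderSeq_box (g := fun x => 1 / x ^ α) hL1 hν hLν htail
    (fun x hx => by positivity)
    (fun x hx => continuousAt_const.div (Real.continuousAt_rpow_const _ _ (Or.inl hx.ne'))
      (Real.rpow_pos_of_pos hx _).ne') t (K := K) (l := l) (u := u)
    (fun i _ => levelOf_lt_levelOf hα ht (hc _) (hcd _))
    (fun i hi => by
      have h1 : Fin.ofNat (K + 1) i = (⟨i, hi⟩ : Fin K).castSucc := hof (⟨i, hi⟩ : Fin K).castSucc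
      have h2 : Fin.ofNat (K + 1) (i + 1) = (⟨i, hi⟩ : Fin K).succ := hof (⟨i, hi⟩ : Fin K).succ
      simp only [l, u, h1, h2]
      rcases (hdc ⟨i, hi⟩).lt_or_eq with h | h
      · exact (levelOf_lt_levelOf hα ht (hd _) h).le
      · rw [h])
    (fun i _ => levelOf_pos ht (hd _))
  have hset : {ω | ∀ i, arrivalVec L α t K ω i ∈ Set.Ioo (c i) (d i)} =
      {ω | ∀ i ≤ K, l i < orderSeq L (i + 1) t ω ∧ orderSeq L (i + 1) t ω < u i} := by
    ext ω
    have hiff : ∀ j : Fin (K + 1), arrivalVec L α t K ω j ∈ Set.Ioo (c j) (d j) ↔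
        l j < orderSeq L (j + 1) t ω ∧ orderSeq L (j + 1) t ω < u j := by
      intro j
      simp only [l, u, hof]
      have h0 : 0 ≤ orderSeq L (j + 1) t ω := nthLargestFlight_nonneg _ _ _
      constructor
      · intro h
        have hX := pos_of_mul_rpow_pos hα h0 ((hc j).trans h.1)
        exact ⟨(mul_rpow_lt_iff hα ht (hd j) hX).1 h.2, (lt_mul_rpow_iff hα ht (hc j) hX).1 h.1⟩
      · intro h
        have hX := (levelOf_pos ht (hd j)).trans h.1
        exact ⟨(lt_mul_rpow_iff hα ht (hc j) hX).2 h.2, (mul_rpow_lt_iff hα ht (hd j) hX).2 h.1⟩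
    constructor
    · intro h i hi
      obtain ⟨j, rfl⟩ := hfin i hi
      exact (hiff j).1 (h j)
    · intro h j
      exact (hiff j).2 (h j (by omega))
  have hg : ∀ a, 0 < a → t * (1 / levelOf α t a ^ α) = a := by
    intro a ha
    rw [one_div, ← Real.rpow_neg (levelOf_pos ht ha).le, mul_rpow_levelOf hα ht ha]
  have hcs : ∀ k : Fin K, Fin.ofNat (K + 1) (k : ℕ) = k.castSucc := fun k => hof k.castSucc
  have hlast : Fin.ofNat (K + 1) K = Fin.last K := hof (Fin.last K)
  rw [hset, ← ofReal_measureReal, hbox, Fin.prod_univ_castSucc]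
  simp only [l, u, hcs, hlast, hg _ (hc _), hg _ (hd _), arrivalMeasure_castSucc,
    arrivalMeasure_last, expDensityMeasure_Ioo (hcd _), Real.volume_Ioo]
  rw [ENNReal.ofReal_mul (Finset.prod_nonneg fun k _ => sub_nonneg.2 (hcd _).le),
    ENNReal.ofReal_prod_of_nonneg fun k _ => sub_nonneg.2 (hcd _).le]

/-- Products of rational intervals generate, and intersecting one with an ordered box raises lower
ends and lowers upper ends. The result is again ordered, so the box formula applies, or empty. -/
lemma IsSelfsimilarOLP.restrict_map_arrivalVec (hL : IsSelfsimilarOLP α L P) (hα : 0 < α)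
    {t : ℝ≥0} (ht : 0 < t) {K : ℕ} {c d : Fin (K + 1) → ℝ} (hc : ∀ i, 0 < c i)
    (hdc : ∀ i : Fin K, d i.castSucc ≤ c i.succ) :
    (P.map (arrivalVec L α t K)).restrict (Set.univ.pi fun i => Set.Ioo (c i) (d i)) =
      (Measure.pi (arrivalMeasure K)).restrict (Set.univ.pi fun i => Set.Ioo (c i) (d i)) := by
  rw [Measure.restrict_pi_pi]
  symm
  refine Measure.pi_eq_generateFrom (fun _ => Real.borel_eq_generateFrom_Ioo_rat.symm)
    (fun _ => Real.isPiSystem_Ioo_rat) (fun _ => Real.finiteSpanningSetsInIooRat _) ?_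
  intro s hs
  have hs' : ∀ i, ∃ a b : ℝ, s i = Set.Ioo a b := by
    intro i
    obtain ⟨a, b, -, h⟩ : ∃ a b : ℚ, a < b ∧ s i = Set.Ioo (a : ℝ) b := by simpa using hs i
    exact ⟨a, b, h⟩
  choose a b hab using hs'
  obtain rfl : s = fun i => Set.Ioo (a i) (b i) := funext hab
  have hmeas : MeasurableSet (Set.univ.pi fun i => Set.Ioo (a i) (b i)) :=
    MeasurableSet.univ_pi fun i => measurableSet_Ioo
  simp_rw [Measure.restrict_apply hmeas, Measure.restrict_apply measurableSet_Ioo,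
    ← Set.pi_inter_distrib, Set.Ioo_inter_Ioo]
  rw [Measure.map_apply_of_aemeasurable (hL.aemeasurable_arrivalVec t K)
    (MeasurableSet.univ_pi fun i => measurableSet_Ioo)]
  by_cases hne : ∀ i, a i ⊔ c i < b i ⊓ d i
  · rw [← hL.measure_arrivalVec_box hα ht (fun i => (hc i).trans_le le_sup_right) hne
      fun i => inf_le_right.trans ((hdc i).trans le_sup_right)]
    congr 1
    ext ω
    simp
  · push Not at hne
    obtain ⟨i, hi⟩ := hne
    rw [Finset.prod_eq_zero (Finset.mem_univ i) (by rw [Set.Ioo_eq_empty (not_lt.2 hi)]; simp),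
      Set.univ_pi_eq_empty (t := fun i => Set.Ioo (a i ⊔ c i) (b i ⊓ d i)) (i := i)
        (Set.Ioo_eq_empty (not_lt.2 hi))]
    simp

/-- On positive increasing vectors, the law of the transformed order sequence is that of the
arrival times of a Poisson process. -/
lemma IsSelfsimilarOLP.map_arrivalVec_apply (hL : IsSelfsimilarOLP α L P) (hα : 0 < α)
    {t : ℝ≥0} (ht : 0 < t) {K : ℕ} {S : Set (Fin (K + 1) → ℝ)} (hS : MeasurableSet S)
    (hpos : ∀ w ∈ S, 0 < w 0) (hinc : ∀ w ∈ S, ∀ i : Fin K, w i.castSucc < w i.succ) :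
    P.map (arrivalVec L α t K) S = Measure.pi (arrivalMeasure K) S := by
  let I := {p : (Fin (K + 1) → ℚ) × (Fin (K + 1) → ℚ) //
    (∀ i, 0 < p.1 i) ∧ ∀ i : Fin K, p.2 i.castSucc ≤ p.1 i.succ}
  let R : I → Set (Fin (K + 1) → ℝ) := fun p =>
    Set.univ.pi fun i => Set.Ioo (p.1.1 i : ℝ) (p.1.2 i : ℝ)
  have hR : (P.map (arrivalVec L α t K)).restrict (⋃ p, R p) =
      (Measure.pi (arrivalMeasure K)).restrict (⋃ p, R p) := by
    rw [Measure.restrict_iUnion_congr]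
    rintro ⟨p, hp1, hp2⟩
    exact hL.restrict_map_arrivalVec hα ht (fun i => by exact_mod_cast hp1 i)
      fun i => by exact_mod_cast hp2 i
  have hsub : S ⊆ ⋃ p, R p := by
    intro w hw
    have h1 : ∀ i : Fin K, ∃ q : ℚ, w i.castSucc < q ∧ (q : ℝ) < w i.succ := fun i =>
      exists_rat_btwn (hinc w hw i)
    choose q hq1 hq2 using h1
    obtain ⟨q0, hq0, hq0'⟩ := exists_rat_btwn (hpos w hw)
    obtain ⟨q1, hq1'⟩ := exists_rat_gt (w (Fin.last K))
    -- Rationals `q i` separating consecutive coordinates serve as upper end of one interval and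
    -- lower end of the next; `q0` and `q1` close the two extremes. Thus countably many ordered
    -- boxes cover `S`.
    refine Set.mem_iUnion.2 ⟨⟨⟨Fin.cons q0 q, Fin.snoc q q1⟩, ?_, fun i => by simp⟩, ?_⟩
    · have hw0 : ∀ i, 0 < w i := by
        intro i
        induction i using Fin.induction with
        | zero => exact hpos w hw
        | succ i ih => exact ih.trans (hinc w hw i)
      intro i
      refine Fin.cases ?_ (fun j => ?_) i
      · simpa using hq0
      · have : (0 : ℝ) < q j := (hw0 j.castSucc).trans (hq1 j)
        simpa using this
    · intro i _
      refine ⟨?_, ?_⟩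
      · refine Fin.cases ?_ (fun j => ?_) i
        · simpa using hq0'
        · simpa using hq2 j
      · refine Fin.lastCases ?_ (fun j => ?_) i
        · simpa using hq1'
        · simpa using hq1 j
  have h := congrArg (fun m : Measure (Fin (K + 1) → ℝ) => m S) hR
  simpa only [Measure.restrict_apply hS, Set.inter_eq_left.2 hsub] using h

end Law

/-! ### The ratio event and its Gamma integral -/

/-- The vectors `w` with `w 0 > 0` whose ratios `w (i + 1) / w 0` lie in the consecutive intervals
`(B i, B (i + 1))`, the last one being unbounded. -/
def ratioSet (n : ℕ) (B : ℕ → ℝ) : Set (Fin (n + 2) → ℝ) :=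
  {w | 0 < w 0 ∧
    (∀ j : Fin n, w j.castSucc.succ ∈ Set.Ioo (B j * w 0) (B (j + 1) * w 0)) ∧
    B n * w 0 < w (Fin.last (n + 1))}

/-- The bound `1 ≤ B 0`, which comes from `a 1 ≤ 1`, places the second coordinate above the first;
ordering is what permits use of the arrival-time law. -/
lemma lt_succ_of_mem_ratioSet {n : ℕ} {B : ℕ → ℝ} (hB0 : 1 ≤ B 0) {w : Fin (n + 2) → ℝ}
    (hw : w ∈ ratioSet n B) (i : Fin (n + 1)) : w i.castSucc < w i.succ := by
  obtain ⟨h0, hmid, hlast⟩ := hw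
  have hlower : B i * w 0 < w i.succ := by
    refine Fin.lastCases ?_ (fun j => ?_) i
    · simpa using hlast
    · simpa using (hmid j).1
  have hupper : w i.castSucc ≤ B i * w 0 := by
    refine Fin.cases ?_ (fun j => ?_) i
    · simpa using le_mul_of_one_le_left h0.le hB0
    · simpa using (hmid j).2.le
  exact hupper.trans_lt hlower

lemma measurableSet_ratioSlices (n : ℕ) (B : ℕ → ℝ) :
    MeasurableSet {p : ℝ × (Fin (n + 1) → ℝ) | 0 < p.1 ∧
      (∀ j : Fin n, p.2 j.castSucc ∈ Set.Ioo (B j * p.1) (B (j + 1) * p.1)) ∧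
      B n * p.1 < p.2 (Fin.last n)} := by
  have : {p : ℝ × (Fin (n + 1) → ℝ) | 0 < p.1 ∧
      (∀ j : Fin n, p.2 j.castSucc ∈ Set.Ioo (B j * p.1) (B (j + 1) * p.1)) ∧
      B n * p.1 < p.2 (Fin.last n)} =
      {p | 0 < p.1} ∩ ((⋂ j : Fin n, ({p | B j * p.1 < p.2 j.castSucc} ∩
        {p | p.2 j.castSucc < B (j + 1) * p.1})) ∩ {p | B n * p.1 < p.2 (Fin.last n)}) := by
    ext; simp
  rw [this]
  refine (measurableSet_lt (by fun_prop) (by fun_prop)).inter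
    (MeasurableSet.inter ?_ (measurableSet_lt (by fun_prop) (by fun_prop)))
  exact MeasurableSet.iInter fun j => (measurableSet_lt (by fun_prop) (by fun_prop)).inter
    (measurableSet_lt (by fun_prop) (by fun_prop))

lemma ratioSet_eq_preimage (n : ℕ) (B : ℕ → ℝ) :
    ratioSet n B = MeasurableEquiv.piFinSuccAbove (fun _ => ℝ) 0 ⁻¹'
      {p : ℝ × (Fin (n + 1) → ℝ) | 0 < p.1 ∧
        (∀ j : Fin n, p.2 j.castSucc ∈ Set.Ioo (B j * p.1) (B (j + 1) * p.1)) ∧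
        B n * p.1 < p.2 (Fin.last n)} := by
  ext w
  rfl

lemma measurableSet_ratioSet (n : ℕ) (B : ℕ → ℝ) : MeasurableSet (ratioSet n B) := by
  rw [ratioSet_eq_preimage]
  exact (MeasurableEquiv.measurable _) (measurableSet_ratioSlices n B)

lemma lintegral_pow_mul_exp (n : ℕ) {b C : ℝ} (hb : 0 < b) (hC : 0 ≤ C) :
    ∫⁻ x in Set.Ioi (0 : ℝ), ENNReal.ofReal (C * (x ^ n * Real.exp (-(b * x)))) =
      ENNReal.ofReal (C * ((1 / b) ^ (n + 1) * Real.Gamma (n + 1))) := by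
  have hG : 0 < Real.Gamma ((n : ℝ) + 1) := Real.Gamma_pos_of_pos (by positivity)
  have h1 : ∫ x in Set.Ioi (0 : ℝ), x ^ n * Real.exp (-(b * x)) =
      (1 / b) ^ (n + 1) * Real.Gamma (n + 1) := by
    have h := Real.integral_rpow_mul_exp_neg_mul_Ioi (a := n + 1) (r := b) (by positivity) hb
    simp only [add_sub_cancel_right, Real.rpow_natCast] at h
    rw [h]
    congr 1
    exact_mod_cast Real.rpow_natCast (1 / b) (n + 1)
  -- A non-integrable function would have integral `0`, but the value just found is positive.
  have hint : IntegrableOn (fun x : ℝ => x ^ n * Real.exp (-(b * x))) (Set.Ioi 0) := by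
    by_contra hcon
    rw [integral_undef hcon] at h1
    have : 0 < (1 / b) ^ (n + 1) * Real.Gamma (n + 1) := by positivity
    linarith
  rw [← ofReal_integral_eq_lintegral_ofReal (hint.const_mul C), integral_const_mul, h1]
  filter_upwards [ae_restrict_mem measurableSet_Ioi] with x hx
  have hx : 0 < x := hx
  change 0 ≤ C * (x ^ n * Real.exp (-(b * x)))
  positivity

/-- With the first coordinate fixed at `x > 0`, the slice is a product of intervals scaled by `x`:
`n` of them carry Lebesgue measure and the last half-line has mass `exp (-(B n * x))`. A Gamma
integral in `x` remains. -/
lemma pi_arrivalMeasure_ratioSet {n : ℕ} {B : ℕ → ℝ} (hB0 : 1 ≤ B 0)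
    (hB : ∀ j < n, B j < B (j + 1)) :
    Measure.pi (arrivalMeasure (n + 1)) (ratioSet n B) =
      ENNReal.ofReal ((∏ j : Fin n, (B (j + 1) - B j)) *
        ((1 / B n) ^ (n + 1) * Real.Gamma (n + 1))) := by
  have hBpos : 0 < B n := by
    have : ∀ j ≤ n, 0 < B j := by
      intro j hj
      induction j with
      | zero => linarith
      | succ j ih => exact (ih (by omega)).trans (hB j (by omega))
    exact this n le_rfl
  have hC : 0 ≤ ∏ j : Fin n, (B (j + 1) - B j) :=
    Finset.prod_nonneg fun j _ => sub_nonneg.2 (hB j j.2).le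
  rw [ratioSet_eq_preimage, (measurePreserving_piFinSuccAbove (arrivalMeasure (n + 1))
    0).measure_preimage (measurableSet_ratioSlices n B).nullMeasurableSet,
    Measure.prod_apply (measurableSet_ratioSlices n B),
    show arrivalMeasure (n + 1) 0 = volume from arrivalMeasure_castSucc 0,
    ← lintegral_pow_mul_exp n hBpos hC, ← lintegral_indicator measurableSet_Ioi]
  refine lintegral_congr fun x => ?_
  by_cases hx : 0 < x
  · rw [Set.indicator_of_mem (show x ∈ Set.Ioi 0 from hx)]
    have hslice : Prod.mk x ⁻¹' {p : ℝ × (Fin (n + 1) → ℝ) | 0 < p.1 ∧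
        (∀ j : Fin n, p.2 j.castSucc ∈ Set.Ioo (B j * p.1) (B (j + 1) * p.1)) ∧
        B n * p.1 < p.2 (Fin.last n)} =
        Set.univ.pi (Fin.snoc (α := fun _ => Set ℝ)
          (fun j : Fin n => Set.Ioo (B j * x) (B (j + 1) * x)) (Set.Ioi (B n * x))) := by
      ext w
      simp only [Set.mem_preimage, Set.mem_ofPred_eq, Set.mem_univ_pi, Fin.forall_fin_succ',
        Fin.snoc_castSucc, Fin.snoc_last, hx, true_and, Set.mem_Ioi]
    rw [hslice, Measure.pi_pi, Fin.prod_univ_castSucc]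
    have hv : ∀ j : Fin n, arrivalMeasure (n + 1) ((0 : Fin (n + 2)).succAbove j.castSucc) =
        volume := fun j => by
      rw [Fin.zero_succAbove, Fin.succ_castSucc]
      exact arrivalMeasure_castSucc _
    have hl : arrivalMeasure (n + 1) ((0 : Fin (n + 2)).succAbove (Fin.last n)) =
        expDensityMeasure := by
      rw [Fin.zero_succAbove, Fin.succ_last]
      exact arrivalMeasure_last _
    simp only [hv, hl, Fin.snoc_castSucc, Fin.snoc_last, Real.volume_Ioo, expDensityMeasure_Ioi]
    rw [← ENNReal.ofReal_prod_of_nonneg fun j _ => ?_, ← ENNReal.ofReal_mul ?_]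
    · congr 1
      simp_rw [← sub_mul]
      rw [Finset.prod_mul_distrib, Finset.prod_const, Finset.card_univ, Fintype.card_fin]
      ring
    · exact Finset.prod_nonneg fun j _ => by
        rw [← sub_mul]; exact mul_nonneg (sub_nonneg.2 (hB j j.2).le) hx.le
    · rw [← sub_mul]; exact mul_nonneg (sub_nonneg.2 (hB j j.2).le) hx.le
  · rw [Set.indicator_of_notMem (show x ∉ Set.Ioi 0 from hx)]
    have hslice : Prod.mk x ⁻¹' {p : ℝ × (Fin (n + 1) → ℝ) | 0 < p.1 ∧
        (∀ j : Fin n, p.2 j.castSucc ∈ Set.Ioo (B j * p.1) (B (j + 1) * p.1)) ∧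
        B n * p.1 < p.2 (Fin.last n)} = ∅ :=
      Set.eq_empty_of_forall_notMem fun w hw => hx hw.1
    rw [hslice, measure_empty]

section Ratios

variable {α : ℝ} {t : ℝ≥0} {a X Y : ℝ}

lemma div_lt_iff_rpow (hα : 0 < α) (ht : 0 < t) (ha : 0 < a) (hX : 0 < X) (hY : 0 < Y) :
    Y / X < a ↔ a ^ (-α) * (t * X ^ (-α)) < t * Y ^ (-α) := by
  have ht' : (0 : ℝ) < t := ht
  rw [div_lt_iff₀ hX, mul_left_comm, mul_lt_mul_iff_right₀ ht', ← Real.mul_rpow ha.le hX.le,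
    Real.rpow_lt_rpow_iff_of_neg (by positivity) hY (by linarith)]

lemma lt_div_iff_rpow (hα : 0 < α) (ht : 0 < t) (ha : 0 < a) (hX : 0 < X) (hY : 0 < Y) :
    a < Y / X ↔ t * Y ^ (-α) < a ^ (-α) * (t * X ^ (-α)) := by
  have ht' : (0 : ℝ) < t := ht
  rw [lt_div_iff₀ hX, mul_left_comm, mul_lt_mul_iff_right₀ ht', ← Real.mul_rpow ha.le hX.le,
    Real.rpow_lt_rpow_iff_of_neg hY (by positivity) (by linarith)]

end Ratios

lemma setOf_ratios_eq_preimage {Ω : Type*} (L : ℝ≥0 → Ω → ℝ) {α : ℝ} (hα : 0 < α) {t : ℝ≥0}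
    (ht : 0 < t) {n : ℕ} {a : ℕ → ℝ} (hpos : ∀ k ∈ Finset.Icc 1 (n + 1), 0 < a k)
    (hlast : a (n + 2) = 0) :
    {ω | ∀ k ∈ Finset.Icc 1 (n + 1),
        a (k + 1) < orderSeq L (k + 1) t ω / orderSeq L 1 t ω ∧
          orderSeq L (k + 1) t ω / orderSeq L 1 t ω < a k} =
      arrivalVec L α t (n + 1) ⁻¹' ratioSet n (fun j => a (j + 1) ^ (-α)) := by
  have ht' : (0 : ℝ) < t := ht
  ext ω
  have h0 : ∀ k, 0 ≤ orderSeq L k t ω := fun k => nthLargestFlight_nonneg _ _ _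
  constructor
  · intro h
    have hann : ∀ k ∈ Finset.Icc 1 (n + 1), 0 ≤ a (k + 1) := by
      intro k hk
      rw [Finset.mem_Icc] at hk
      rcases hk.2.lt_or_eq with hlt | rfl
      · exact (hpos _ (Finset.mem_Icc.2 ⟨by omega, hlt⟩)).le
      · exact hlast.ge
    have hq : ∀ k ∈ Finset.Icc 1 (n + 1), 0 < orderSeq L (k + 1) t ω / orderSeq L 1 t ω :=
      fun k hk => (hann k hk).trans_lt (h k hk).1
    have hX : 0 < orderSeq L 1 t ω := by
      refine (h0 1).lt_of_ne fun heq => ?_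
      have := hq 1 (Finset.mem_Icc.2 ⟨le_rfl, by omega⟩)
      -- If the largest flight is `0`, the ratio is `0` by convention, contradicting its positivity.
      rw [← heq, div_zero] at this
      exact lt_irrefl _ this
    have hY : ∀ k ∈ Finset.Icc 1 (n + 1), 0 < orderSeq L (k + 1) t ω := fun k hk =>
      (div_pos_iff_of_pos_right hX).1 (hq k hk)
    refine ⟨?_, fun j => ?_, ?_⟩
    · have := Real.rpow_pos_of_pos hX (-α)
      simpa [arrivalVec] using mul_pos ht' this
    · have hj := j.2
      have hk : (j : ℕ) + 1 ∈ Finset.Icc 1 (n + 1) := Finset.mem_Icc.2 ⟨by omega, by omega⟩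
      have hk' : (j : ℕ) + 1 + 1 ∈ Finset.Icc 1 (n + 1) := Finset.mem_Icc.2 ⟨by omega, by omega⟩
      have h1 := (div_lt_iff_rpow hα ht (hpos _ hk) hX (hY _ hk)).1 (h _ hk).2
      have h2 := (lt_div_iff_rpow hα ht (hpos _ hk') hX (hY _ hk)).1 (h _ hk).1
      simpa [arrivalVec] using And.intro h1 h2
    · have hk : n + 1 ∈ Finset.Icc 1 (n + 1) := Finset.mem_Icc.2 ⟨by omega, le_rfl⟩
      have h1 := (div_lt_iff_rpow hα ht (hpos _ hk) hX (hY _ hk)).1 (h _ hk).2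
      simpa [arrivalVec] using h1
  · rintro ⟨h1, h2, h3⟩ k hk
    have h1' : 0 < t * orderSeq L 1 t ω ^ (-α) := by simpa [arrivalVec] using h1
    have hX := pos_of_mul_rpow_pos hα (h0 1) h1'
    have hlow : ∀ j ≤ n, a (j + 1) ^ (-α) * (t * orderSeq L 1 t ω ^ (-α)) <
        t * orderSeq L (j + 1 + 1) t ω ^ (-α) := by
      intro j hj
      rcases hj.lt_or_eq with hlt | rfl
      · simpa [arrivalVec] using (h2 ⟨j, hlt⟩).1
      · simpa [arrivalVec] using h3
    obtain ⟨j, rfl⟩ : ∃ j, k = j + 1 := ⟨k - 1, by have := (Finset.mem_Icc.1 hk).1; omega⟩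
    have hj : j ≤ n := by have := (Finset.mem_Icc.1 hk).2; omega
    have hY : 0 < orderSeq L (j + 1 + 1) t ω := by
      refine pos_of_mul_rpow_pos hα (h0 _) (lt_of_le_of_lt ?_ (hlow j hj))
      have := Real.rpow_pos_of_pos (hpos _ hk) (-α)
      positivity
    refine ⟨?_, (div_lt_iff_rpow hα ht (hpos _ hk) hX hY).2 (hlow j hj)⟩
    rcases hj.lt_or_eq with hlt | rfl
    · rw [lt_div_iff_rpow hα ht (hpos _ (Finset.mem_Icc.2 ⟨by omega, by omega⟩)) hX hY]
      simpa [arrivalVec] using (h2 ⟨j, hlt⟩).2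
    · rw [hlast]
      positivity

theorem mainTheorem4 {Ω : Type*} [MeasurableSpace Ω] (P : Measure Ω) [IsProbabilityMeasure P]
    (α : ℝ) (hα0 : 0 < α) (hα1 : α < 1)
    (L : ℝ≥0 → Ω → ℝ) (hL : IsSelfsimilarOLP α L P)
    (t : ℝ≥0) (ht : 0 < t)
    (K : ℕ) (hK : 1 ≤ K) (a : ℕ → ℝ)
    (ha_one : a 1 ≤ 1)
    (ha_anti : ∀ k ∈ Finset.Icc 1 K, a (k + 1) < a k)
    (ha_last : a (K + 1) = 0) :
    NullMeasurableSet {ω | ∀ k ∈ Finset.Icc 1 K,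
        a (k + 1) < orderSeq L (k + 1) t ω / orderSeq L 1 t ω ∧
          orderSeq L (k + 1) t ω / orderSeq L 1 t ω < a k} P ∧
      P {ω | ∀ k ∈ Finset.Icc 1 K,
        a (k + 1) < orderSeq L (k + 1) t ω / orderSeq L 1 t ω ∧
          orderSeq L (k + 1) t ω / orderSeq L 1 t ω < a k} =
        ENNReal.ofReal (Real.Gamma K * a K ^ (α * K) *
          ∏ k ∈ Finset.Icc 1 (K - 1), (1 / a (k + 1) ^ α - 1 / a k ^ α)) := by
  obtain ⟨n, rfl⟩ : ∃ n, K = n + 1 := ⟨K - 1, by omega⟩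
  have hpos : ∀ k ∈ Finset.Icc 1 (n + 1), 0 < a k := by
    intro k hk
    rw [Finset.mem_Icc] at hk
    obtain ⟨hk1, hk2⟩ := hk
    -- Positivity descends from `a (n + 1) > a (n + 2) = 0`.
    induction hk2 using Nat.decreasingInduction with
    | self => exact ha_last ▸ ha_anti (n + 1) (Finset.mem_Icc.2 ⟨by omega, le_rfl⟩)
    | of_succ k hlt ih =>
      exact (ih (by omega)).trans (ha_anti k (Finset.mem_Icc.2 ⟨hk1, by omega⟩))
  have hB0 : 1 ≤ a (0 + 1) ^ (-α) :=
    Real.one_le_rpow_of_pos_of_le_one_of_nonpos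
      (hpos 1 (Finset.mem_Icc.2 ⟨le_rfl, by omega⟩)) ha_one (by linarith)
  have hB : ∀ j < n, a (j + 1) ^ (-α) < a (j + 1 + 1) ^ (-α) := fun j hj =>
    Real.rpow_lt_rpow_of_neg (hpos _ (Finset.mem_Icc.2 ⟨by omega, by omega⟩))
      (ha_anti _ (Finset.mem_Icc.2 ⟨by omega, by omega⟩)) (by linarith)
  have hmeas := measurableSet_ratioSet n (fun j => a (j + 1) ^ (-α))
  have hae := hL.aemeasurable_arrivalVec t (n + 1)
  rw [setOf_ratios_eq_preimage L hα0 ht hpos ha_last]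
  refine ⟨hae.nullMeasurable hmeas, ?_⟩
  rw [← Measure.map_apply_of_aemeasurable hae hmeas,
    hL.map_arrivalVec_apply hα0 ht hmeas (fun w hw => hw.1)
      (fun w hw => lt_succ_of_mem_ratioSet hB0 hw),
    pi_arrivalMeasure_ratioSet (B := fun j => a (j + 1) ^ (-α)) hB0 hB]
  congr 1
  have han := hpos (n + 1) (Finset.mem_Icc.2 ⟨by omega, le_rfl⟩)
  have h1 : (1 / a (n + 1) ^ (-α)) ^ (n + 1) = a (n + 1) ^ (α * ((n + 1 : ℕ) : ℝ)) := by
    rw [Real.rpow_neg han.le, one_div, inv_inv, Real.rpow_mul han.le, Real.rpow_natCast]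
  have h2 : ∏ j : Fin n, (a (j + 1 + 1) ^ (-α) - a (j + 1) ^ (-α)) =
      ∏ k ∈ Finset.Icc 1 n, (1 / a (k + 1) ^ α - 1 / a k ^ α) := by
    rw [← Finset.prod_range fun j => a (j + 1 + 1) ^ (-α) - a (j + 1) ^ (-α),
      Finset.range_eq_Ico, Finset.prod_Ico_add' (fun k => a (k + 1) ^ (-α) - a k ^ (-α)) 0 n 1]
    refine Finset.prod_congr (by ext; simp) fun k hk => ?_
    rw [Finset.mem_Icc] at hk
    rw [Real.rpow_neg (hpos _ (Finset.mem_Icc.2 ⟨by omega, by omega⟩)).le,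
      Real.rpow_neg (hpos _ (Finset.mem_Icc.2 ⟨by omega, by omega⟩)).le, one_div, one_div]
  rw [h1, h2, Nat.add_sub_cancel]
  push_cast
  ring
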